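/- **Setting.** Two periods $t=1,2$. A unit has ground-truth potential outcomes $M_t^{*,2}$ (first treated in period 2) and $M_t^{*,0}$ (untreated), treatment indicators $D_1,D_2$, annotation indicators $A_1,A_2\in\{0,1\}$, covariates $X=(X_1,X_2)$ and unstructured data $U=(U_1,U_2)$. Let $G=\mathbb 1\{D_1=0,D_2=1\}$ (treated cohort), $C=\mathbb 1\{D_1=D_2=0\}$ (never treated), $M_t^*=M_t^{*,0}+(M_t^{*,2}-M_t^{*,0})G$, $M^*=M_2^*-M_1^*$, $A=A_1A_2$, $\tilde X=(X_1,X_2,U_1,U_2)$. One observes $W=(M_1,M_2,D_1,D_2,A_1,A_2,X_1,X_2,U_1,U_2)$ with $M_t=A_tM_t^*$, and $M:=M_2-M_1$; let $P$ be the law of $W$. The target is the ATT $$\theta=E\big[M_2^{*,2}-M_2^{*,0}\mid G=1\big].$$ **Assumptions.** (i) $D_1=0$ a.s.; $p_G=P(G=1)>0$ and $p_C=P(C=1)>0$ are known; $M_t^{*,2},M_t^{*,0}$ are integrable given $G=1$ and $M_t^{*,0}$ is integrable given $C=1$; $E[(M^*)^2]<\infty$. (ii) No anticipation: $E[M_1^{*,2}\mid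 G=1]=E[M_1^{*,0}\mid G=1]$. (iii) Parallel trends: $E[M_2^{*,0}-M_1^{*,0}\mid G=1]=E[M_2^{*,0}-M_1^{*,0}\mid C=1]$. (iv) Missing at random: $(U,M^*)\perp A\mid X$ and $(C,G)\perp A\mid (X,U,M^*)$. (v) The annotation score $\pi(x)=P(A=1\mid X=x)$ is known, with $\eta\le\pi(x)\le 1$ for all $x$, for some $0<\eta<1$. Let $\mu_G(\tilde x)=E[M\mid G=1,A=1,\tilde X=\tilde x]$, $\mu_C(\tilde x)=E[M\mid C=1,A=1,\tilde X=\tilde x]$. Let $W_1,W_2,\dots$ be iid with law $P$ and let $\mathcal I,\mathcal I'$ be disjoint finite index sets (estimation and tuning sample). Let $\hat\mu_G,\hat\mu_C$ be (jointly measurable) functions of the tuning data $\{W_i\}_{i\in\mathcal I'}$ and of $\tilde x$ with $E\int(\hat\mu_g-\mu_g)^2\,dP_{\tilde X}\to0$ for $g=G,C$. Put $$\hat\theta_g=\frac1{|\mathcal I|}\sum_{i\in\mathcal I}\frac{g_i}{p_g}\Big[\hat\mu_g(\tilde X_i)+\frac{A_i}{\pi(X_i)}\big(M_i-\hat\mu_g(\tilde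 X_i)\big)\Big],\qquad \hat\theta=\hat\theta_G-\hat\theta_C,$$ $$\varphi_g(W)=\frac{g}{p_g}\Big[\mu_g(\tilde X)+\frac{A}{\pi(X)}\big(M-\mu_g(\tilde X)\big)\Big]-E[\mu_g(\tilde X)\mid g=1],\qquad \varphi=\varphi_G-\varphi_C .$$ **Proposition.** The ATT is identified: $\theta=\psi(P)$, where for a law $Q$ of the observed data, with the weights $p_G,p_C$ held fixed as known constants, $$\psi(Q)=E_Q\Big[\tfrac{G}{p_G}\,\mu_{G,Q}(\tilde X)\Big]-E_Q\Big[\tfrac{C}{p_C}\,\mu_{C,Q}(\tilde X)\Big],\qquad \mu_{g,Q}(\tilde X)=E_Q[M\mid g=1,A=1,\tilde X].$$ As $|\mathcal I|,|\mathcal I'|\to\infty$, $$\sqrt{|\mathcal I|}\,(\hat\theta-\theta)\xrightarrow{d}N\big(0,\operatorname{Var}(\varphi(W))\big).$$ Moreover $\varphi$ is the efficient influence function of the ATT, that is, of $\psi$ at $P$, in the semiparametric model $\mathcal P_\pi$ with known annotation score. Here $\mathcal P_\pi$ is the set of all laws $Q$ of the observed data with $Q(A=1\mid\tilde X,G,C)=\pi(X)$,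 $D_1=0$ a.s., $M_t=0$ a.s. on $\{A_t=0\}$ and $E_Q[AM^2]<\infty$. Explicitly, for every submodel $t\mapsto Q_t\in\mathcal P_\pi$, $t\downarrow0$, through $P$ that is differentiable in quadratic mean with score $h$ and along which $E_{Q_t}[AM^2]$ stays bounded, $(\psi(Q_t)-\psi(P))/t\to E_P[\varphi h]$; and $\varphi$ lies in the closed linear span in $L^2(P)$ of the scores of these submodels. -/

import Mathlib

open MeasureTheory ProbabilityTheory Filter Topology
open scoped ENNReal NNReal

/-! ### Efficient influence functions in a statistical model -/

namespace Semiparametric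

/-- `Q` is a one-dimensional submodel `t ↦ Q t`, `t ↓ 0`, through `P`, differentiable in quadratic
mean with score `h`:
`∫ [ ((dQ_t)^{1/2} - (dP)^{1/2}) / t - (1/2) h (dP)^{1/2} ]² → 0`.
The densities are taken with respect to `P + Q t`; the value of the integral does not depend on the
dominating measure. -/
def IsQMDPath {𝒲 : Type*} [MeasurableSpace 𝒲] (P : Measure 𝒲) (Q : ℝ → Measure 𝒲)
    (h : 𝒲 → ℝ) : Prop :=
  Q 0 = P ∧ MemLp h 2 P ∧
  Tendsto (fun t : ℝ => ∫⁻ w, ENNReal.ofReal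
      (((Real.sqrt ((Q t).rnDeriv (P + Q t) w).toReal
            - Real.sqrt (P.rnDeriv (P + Q t) w).toReal) / t
          - 1 / 2 * h w * Real.sqrt (P.rnDeriv (P + Q t) w).toReal) ^ 2) ∂(P + Q t))
    (𝓝[>] 0) (𝓝 0)

/-- The tangent set at `P`: all scores of the submodels in the class `paths`. -/
def tangentSet {𝒲 : Type*} [MeasurableSpace 𝒲] (paths : Set (ℝ → Measure 𝒲))
    (P : Measure 𝒲) : Set (𝒲 → ℝ) :=
  {h | ∃ Q ∈ paths, IsQMDPath P Q h}

/-- `φ` is the efficient influence function at `P` of the functional `ψ`, relative to the class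
`paths` of submodels: `ψ` is pathwise differentiable, with derivative `h ↦ E_P[φ h]` along every
submodel with score `h`, and `φ` belongs to the closed linear span in `L²(P)` of the tangent set. -/
def IsEfficientInfluenceFunction {𝒲 : Type*} [MeasurableSpace 𝒲]
    (paths : Set (ℝ → Measure 𝒲)) (ψ : Measure 𝒲 → ℝ) (P : Measure 𝒲) (φ : 𝒲 → ℝ) : Prop :=
  MemLp φ 2 P ∧
  (∀ Q ∈ paths, ∀ h : 𝒲 → ℝ, IsQMDPath P Q h →
    Tendsto (fun t : ℝ => (ψ (Q t) - ψ P) / t) (𝓝[>] 0) (𝓝 (∫ w, φ w * h w ∂P))) ∧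
  (∀ ε : ℝ≥0∞, 0 < ε → ∃ s ∈ Submodule.span ℝ (tangentSet paths P), eLpNorm (φ - s) 2 P < ε)

end Semiparametric

/-! ### Two-period difference-in-differences with an outcome missing at random

The two periods are indexed by `Fin 2` (`0` is period 1, `1` is period 2). -/

namespace DiD

/-- The `0`-`1` variable of a Boolean indicator. -/
def ind (b : Bool) : ℝ := if b then 1 else 0

/-- The feature space of `(X₁, X₂, U₁, U₂)`. -/
abbrev Feat (k l : ℕ) : Type := (Fin 2 → Fin k → ℝ) × (Fin 2 → Fin l → ℝ)

/-- Complete data of a unit: ground truth potential outcomes (`Y true t` when first treated in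
period 2, `Y false t` when untreated), treatments `D t`, annotation indicators `A t`, features. -/
abbrev Full (k l : ℕ) : Type :=
  (Bool → Fin 2 → ℝ) × (Fin 2 → Bool) × (Fin 2 → Bool) × Feat k l

instance {k l : ℕ} : StandardBorelSpace (Feat k l) := StandardBorelSpace.prod

instance {k l : ℕ} : StandardBorelSpace (Full k l) :=
  @StandardBorelSpace.prod _ _ _ _ _ (@StandardBorelSpace.prod _ _ _ _ _
    (@StandardBorelSpace.prod _ _ _ _ _ inferInstance))

/-- Observed data of a unit, `W = (M₁, M₂, D₁, D₂, A₁, A₂, X₁, X₂, U₁, U₂)`. -/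
abbrev Obs (k l : ℕ) : Type :=
  (Fin 2 → ℝ) × (Fin 2 → Bool) × (Fin 2 → Bool) × Feat k l

/-- `G`: first treated in period 2. -/
def cohort (d : Fin 2 → Bool) : Bool := !d 0 && d 1

/-- `C`: never treated. -/
def never (d : Fin 2 → Bool) : Bool := !d 0 && !d 1

/-- `A = A₁ A₂`: annotated in both periods. -/
def both (a : Fin 2 → Bool) : Bool := a 0 && a 1

namespace Full

variable {k l : ℕ}

def Y (z : Full k l) : Bool → Fin 2 → ℝ := z.1
def G (z : Full k l) : Bool := cohort z.2.1
def C (z : Full k l) : Bool := never z.2.1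
def A (z : Full k l) : Bool := both z.2.2.1
def X (z : Full k l) : Fin 2 → Fin k → ℝ := z.2.2.2.1
def U (z : Full k l) : Fin 2 → Fin l → ℝ := z.2.2.2.2

/-- Ground truth outcome in period `t`. -/
def truth (z : Full k l) (t : Fin 2) : ℝ :=
  z.Y false t + (z.Y true t - z.Y false t) * ind z.G

/-- Ground truth outcome change `M* = M₂* - M₁*`. -/
def Mstar (z : Full k l) : ℝ := z.truth 1 - z.truth 0

/-- What is observed: the ground truth outcome of a period is revealed when the period is
annotated, `M_t = A_t M_t*`. -/
def obs (z : Full k l) : Obs k l := (fun t => ind (z.2.2.1 t) * z.truth t, z.2)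

lemma measurable_X : Measurable (X : Full k l → _) := by unfold X; fun_prop

lemma measurable_U : Measurable (U : Full k l → _) := by unfold U; fun_prop

lemma measurable_truth (t : Fin 2) : Measurable (fun z : Full k l => z.truth t) := by
  have h : Measurable (fun z : Full k l => ind z.G) :=
    (Measurable.of_discrete (f := fun d : Fin 2 → Bool => ind (cohort d))).comp
      (measurable_fst.comp measurable_snd)
  have hY (b : Bool) : Measurable (fun z : Full k l => z.Y b t) := by unfold Y; fun_prop
  exact (hY false).add (((hY true).sub (hY false)).mul h)

lemma measurable_Mstar : Measurable (Mstar : Full k l → ℝ) :=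
  (measurable_truth 1).sub (measurable_truth 0)

end Full

namespace Obs

variable {k l : ℕ}

/-- `M = M₂ - M₁`. -/
def M (w : Obs k l) : ℝ := w.1 1 - w.1 0
def D (w : Obs k l) : Fin 2 → Bool := w.2.1
def G (w : Obs k l) : Bool := cohort w.2.1
def C (w : Obs k l) : Bool := never w.2.1
def A (w : Obs k l) : Bool := both w.2.2.1
def X (w : Obs k l) : Fin 2 → Fin k → ℝ := w.2.2.2.1
/-- `X̃ = (X₁, X₂, U₁, U₂)`. -/
def feat (w : Obs k l) : Feat k l := w.2.2.2

end Obs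

/-- The assumptions on the law `F` of the complete data of a unit, with known annotation score
function `π`. -/
structure Assumptions {k l : ℕ} (F : Measure (Full k l)) [IsProbabilityMeasure F]
    (π : (Fin 2 → Fin k → ℝ) → ℝ) : Prop where
  /-- irreversibility of treatment: nobody is treated in period 1 -/
  irreversible : ∀ᵐ z ∂F, z.2.1 0 = false
  pos_cohort : 0 < F {z | z.G}
  pos_never : 0 < F {z | z.C}
  /-- the means of the potential outcomes below exist -/
  integrable_cohort : ∀ b t, Integrable (fun z => z.Y b t) F[|{z | z.G}]
  integrable_never : ∀ t, Integrable (fun z => z.Y false t) F[|{z | z.C}]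
  /-- no anticipation -/
  no_anticipation : ∫ z, z.Y true 0 ∂F[|{z | z.G}] = ∫ z, z.Y false 0 ∂F[|{z | z.G}]
  /-- parallel trends, based on the never-treated -/
  parallel_trends : ∫ z, (z.Y false 1 - z.Y false 0) ∂F[|{z | z.G}]
    = ∫ z, (z.Y false 1 - z.Y false 0) ∂F[|{z | z.C}]
  /-- finite variance of the outcome change -/
  memLp_Mstar : MemLp Full.Mstar 2 F
  /-- missing at random: `(U, M*) ⟂ A ∣ X` -/
  missing_at_random : CondIndepFun (MeasurableSpace.comap Full.X inferInstance)
    Full.measurable_X.comap_le (fun z => (z.U, z.Mstar)) Full.A F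
  /-- `(C, G) ⟂ A ∣ (X, U, M*)` -/
  groups_missing_at_random :
    CondIndepFun (MeasurableSpace.comap (fun z : Full k l => (z.X, z.U, z.Mstar)) inferInstance)
      (Full.measurable_X.prodMk
        (Full.measurable_U.prodMk Full.measurable_Mstar)).comap_le
      (fun z => (z.C, z.G)) Full.A F
  /-- `π(x) = P(A = 1 ∣ X = x)` -/
  measurable_score : Measurable π
  score : F[fun z => ind z.A | MeasurableSpace.comap Full.X inferInstance] =ᵐ[F] fun z => π z.X
  /-- the annotation score is bounded away from zero -/
  overlap : ∃ η : ℝ, 0 < η ∧ η < 1 ∧ ∀ x, η ≤ π x ∧ π x ≤ 1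

/-- The average treatment effect on the treated cohort in period 2. -/
noncomputable def att {k l : ℕ} (F : Measure (Full k l)) : ℝ :=
  ∫ z, (z.Y true 1 - z.Y false 1) ∂F[|{z | z.G}]

/-- The regression of `M` on `X̃` among annotated units of the group `g` (`g` is `Obs.G` or `Obs.C`),
`E_Q[M ∣ g = 1, A = 1, X̃]`, as a function of `W`. -/
noncomputable def regression {k l : ℕ} (g : Obs k l → Bool) (Q : Measure (Obs k l)) :
    Obs k l → ℝ :=
  (Q[|{w | g w = true ∧ w.A = true}])[Obs.M | MeasurableSpace.comap Obs.feat inferInstance]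

/-- `mu` is a version of the function `x̃ ↦ E_P[M ∣ g = 1, A = 1, X̃ = x̃]`. -/
def IsRegression {k l : ℕ} (g : Obs k l → Bool) (P : Measure (Obs k l)) (mu : Feat k l → ℝ) :
    Prop :=
  Measurable mu ∧
    (fun w => mu w.feat) =ᵐ[P[|{w | g w = true ∧ w.A = true}]] regression g P

/-- The identified functional
`Q ↦ E_Q[(G / p_G) μ_{G,Q}(X̃)] - E_Q[(C / p_C) μ_{C,Q}(X̃)]`, with known weights `p_G`, `p_C`. -/
noncomputable def identified {k l : ℕ} (pG pC : ℝ) (Q : Measure (Obs k l)) : ℝ :=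
  ∫ w, ind w.G / pG * regression Obs.G Q w ∂Q - ∫ w, ind w.C / pC * regression Obs.C Q w ∂Q

/-- The semiparametric model with known annotation score function `π`: all laws `Q` of the observed
data for which `Q(A = 1 ∣ X, U, G, C) = π(X)` (the outcome change having a finite second moment
among the annotated, nobody being treated in period 1, outcomes of unannotated periods being
recorded as `0`). -/
def model {k l : ℕ} (π : (Fin 2 → Fin k → ℝ) → ℝ) : Set (Measure (Obs k l)) :=
  {Q | IsProbabilityMeasure Q ∧
    (∀ᵐ w ∂Q, w.D 0 = false) ∧
    (∀ᵐ w ∂Q, ∀ t, w.2.2.1 t = false → w.1 t = 0) ∧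
    (∫⁻ w, ENNReal.ofReal (ind w.A * w.M ^ 2) ∂Q < ∞) ∧
    Q[fun w => ind w.A | MeasurableSpace.comap
        (fun w : Obs k l => (w.feat, w.G, w.C)) inferInstance] =ᵐ[Q] fun w => π w.X}

/-- The submodels of the semiparametric model along which the second moment of the annotated outcome
change stays bounded. -/
def regularPaths {k l : ℕ} (π : (Fin 2 → Fin k → ℝ) → ℝ) : Set (ℝ → Measure (Obs k l)) :=
  {Q | (∀ᶠ t in 𝓝[>] (0 : ℝ), Q t ∈ model π) ∧
    ∃ B : ℝ≥0, ∀ᶠ t in 𝓝[>] (0 : ℝ),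
      ∫⁻ w, ENNReal.ofReal (ind w.A * w.M ^ 2) ∂(Q t) ≤ B}

/-- `(g / p) [μ(X̃) + (A / π(X)) (M - μ(X̃))]` -/
noncomputable def aipw {k l : ℕ} (π : (Fin 2 → Fin k → ℝ) → ℝ) (g : Obs k l → Bool) (p : ℝ)
    (mu : Feat k l → ℝ) (w : Obs k l) : ℝ :=
  ind (g w) / p * (mu w.feat + ind w.A / π w.X * (w.M - mu w.feat))

/-- `φ_g = (g / p) [μ(X̃) + (A / π(X)) (M - μ(X̃))] - θ_g`, where `p = P(g = 1)` and
`θ_g = E_P[μ(X̃) ∣ g = 1]`. -/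
noncomputable def influence {k l : ℕ} (P : Measure (Obs k l)) (π : (Fin 2 → Fin k → ℝ) → ℝ)
    (g : Obs k l → Bool) (mu : Feat k l → ℝ) (w : Obs k l) : ℝ :=
  aipw π g (P.real {w | g w}) mu w - ∫ w', mu w'.feat ∂P[|{w | g w}]

/-- The estimator `θ̂_g = |I|⁻¹ ∑_{i ∈ I} (g_i / p) [μ̂(X̃_i) + (A_i / π(X_i)) (M_i - μ̂(X̃_i))]`,
where `p = P(g = 1)`, from the data `W` of the units in the estimation sample `I`. -/
noncomputable def estimator {k l : ℕ} (P : Measure (Obs k l)) (π : (Fin 2 → Fin k → ℝ) → ℝ)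
    (g : Obs k l → Bool) (muHat : Feat k l → ℝ) (I : Finset ℕ) (W : ℕ → Obs k l) : ℝ :=
  1 / (I.card : ℝ) * ∑ i ∈ I, aipw π g (P.real {w | g w}) muHat (W i)

/-- Expected squared `L²(P_X̃)` error of an imputation function `muHat`, a function of the training
data `W_i`, `i ∈ I'`. -/
noncomputable def mse {k l : ℕ} {Ω : Type*} [MeasurableSpace Ω] (ρ : Measure Ω)
    (P : Measure (Obs k l)) (W : ℕ → Ω → Obs k l) (I' : Finset ℕ)
    (muHat : (I' → Obs k l) → Feat k l → ℝ) (mu : Feat k l → ℝ) : ℝ≥0∞ :=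
  ∫⁻ ω, ∫⁻ x, ENNReal.ofReal ((muHat (fun i => W i ω) x - mu x) ^ 2) ∂(P.map Obs.feat) ∂ρ

end DiD

/-! Write S for the strata (X̃, G, C).

Linearity. In the model π(X) is the conditional probability of annotation given S, so weighting
annotated units by 1/π recovers group means. Hence ψ(Q) = E_Q[f] on the whole model, with the fixed
integrand f = (G/p_G - C/p_C) A M / π (`identified_eq_integral`). For the complete data, missingness
at random makes π(X) the score given (X, U, M*, C, G) as well, so ψ(P) = E[M* | G = 1] - E[M* | C =
1], which is the ATT by no anticipation and parallel trends.

Derivative. A linear functional E_Q[f] whose integrand has bounded second moment along a path with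
score h has derivative E_P[f h] (`IsQMDPath.tendsto_diffQuotient`). The gradient f is not the
efficient one: f - φ = (A - π) σ(S) + constant, where σ = (G μ_G/p_G - C μ_C/p_C)/π. But E_Q[(A - π)
b(S)] vanishes throughout the model and the total mass is always 1. Differentiating these constant
functionals shows that every score is orthogonal to f - φ, so E_P[f h] = E_P[φ h].

Efficiency. A score splits into variations of the law of S, of A given S, and of the remaining data
given (S, A). Knowing π forbids exactly the middle one, so the projection onto the tangent space is
T u = u - E[u | S, A] + E[u | S] - E[u] (`tangentProj`). For bounded u the density 1 + t T u stays
in the model for small t, so T u is a score. Regression residuals have mean zero given (S, A),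
whence T φ = φ; approximating φ by simple functions u and using that T is Lipschitz on L² puts φ in
the closed span.

Asymptotic normality. Replacing μ by μ̂ changes each summand by (1 - A/π) (g/p) (μ̂ - μ)(X̃). Given
the tuning sample these terms are iid and centred whatever μ̂ is, because E[A/π | S] = 1. The
normalized sum therefore has second moment at most a constant times the mean squared error, and
consistency without a rate suffices (`lintegral_sq_remainder_le`). The normalized sum of φ(W_i)
remains, and the central limit theorem and Slutsky's lemma conclude. -/

namespace Semiparametric

/-! ### Differentiability in quadratic mean and linear functionals -/

variable {𝒲 : Type*} [MeasurableSpace 𝒲]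

/-- Cauchy-Schwarz for real functions. -/
lemma abs_integral_mul_le {μ : Measure 𝒲} {a b : 𝒲 → ℝ} (ha : MemLp a 2 μ) (hb : MemLp b 2 μ) :
    |∫ w, a w * b w ∂μ| ≤ √(∫ w, a w ^ 2 ∂μ) * √(∫ w, b w ^ 2 ∂μ) := by
  have h := integral_mul_norm_le_Lp_mul_Lq (μ := μ) (f := a) (g := b) (p := 2) (q := 2)
    ⟨by norm_num, by norm_num, by norm_num⟩ (by simpa using ha) (by simpa using hb)
  simp only [Real.norm_eq_abs, Real.rpow_ofNat, sq_abs, ← Real.sqrt_eq_rpow] at h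
  refine le_trans (abs_integral_le_integral_abs) ?_
  simpa [abs_mul] using h

/-- The square root of the density of `P` with respect to `ν`. -/
noncomputable def rootDensity (P ν : Measure 𝒲) (w : 𝒲) : ℝ := √(P.rnDeriv ν w).toReal

lemma measurable_rootDensity (P ν : Measure 𝒲) : Measurable (rootDensity P ν) :=
  (Measure.measurable_rnDeriv P ν).ennreal_toReal.sqrt

lemma rootDensity_sq (P ν : Measure 𝒲) (w : 𝒲) :
    rootDensity P ν w ^ 2 = (P.rnDeriv ν w).toReal :=
  Real.sq_sqrt ENNReal.toReal_nonneg

lemma integral_mul_rootDensity_sq {P ν : Measure 𝒲} [IsFiniteMeasure P] [IsFiniteMeasure ν]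
    (hP : P ≪ ν) (f : 𝒲 → ℝ) :
    ∫ w, f w * rootDensity P ν w ^ 2 ∂ν = ∫ w, f w ∂P := by
  rw [← integral_toReal_rnDeriv_mul hP]
  exact integral_congr_ae (.of_forall fun w => by simp only [rootDensity_sq]; ring)

lemma integrable_mul_rootDensity_sq {P ν : Measure 𝒲} [IsFiniteMeasure P] [IsFiniteMeasure ν]
    (hP : P ≪ ν) {f : 𝒲 → ℝ} (hf : Integrable f P) :
    Integrable (fun w => f w * rootDensity P ν w ^ 2) ν := by
  refine ((integrable_toReal_rnDeriv_mul_iff hP).2 hf).congr (.of_forall fun w => ?_)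
  simp only [rootDensity_sq]; ring

lemma memLp_mul_rootDensity {P ν : Measure 𝒲} [IsFiniteMeasure P] [IsFiniteMeasure ν]
    (hP : P ≪ ν) {f : 𝒲 → ℝ} (hfm : Measurable f) (hf : MemLp f 2 P) :
    MemLp (fun w => f w * rootDensity P ν w) 2 ν := by
  refine (memLp_two_iff_integrable_sq
    (hfm.mul (measurable_rootDensity P ν)).aestronglyMeasurable).2 ?_
  simpa only [Pi.mul_apply, mul_pow] using integrable_mul_rootDensity_sq hP hf.integrable_sq

lemma sqrt_integral_mul_rootDensity {P ν : Measure 𝒲} [IsFiniteMeasure P] [IsFiniteMeasure ν]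
    (hP : P ≪ ν) (f : 𝒲 → ℝ) :
    √(∫ w, (f w * rootDensity P ν w) ^ 2 ∂ν) = √(∫ w, f w ^ 2 ∂P) := by
  simp only [mul_pow]
  rw [integral_mul_rootDensity_sq hP (fun w => f w ^ 2)]

/-- The remainder in the definition of differentiability in quadratic mean. -/
noncomputable def qmdRemainder (P Q : Measure 𝒲) (h : 𝒲 → ℝ) (t : ℝ) (w : 𝒲) : ℝ :=
  (rootDensity Q (P + Q) w - rootDensity P (P + Q) w) / t
    - 1 / 2 * h w * rootDensity P (P + Q) w

lemma memLp_qmdRemainder {P Q : Measure 𝒲} [IsFiniteMeasure P] [IsFiniteMeasure Q] {h : 𝒲 → ℝ}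
    (hm : Measurable h) (hh : MemLp h 2 P) (t : ℝ) : MemLp (qmdRemainder P Q h t) 2 (P + Q) := by
  have hP : P ≪ P + Q := Measure.absolutelyContinuous_of_le (Measure.le_add_right le_rfl)
  have hQ : Q ≪ P + Q := Measure.absolutelyContinuous_of_le (Measure.le_add_left le_rfl)
  have h1 := memLp_mul_rootDensity hP (f := fun _ => (1 : ℝ)) measurable_const (memLp_const 1)
  have h2 := memLp_mul_rootDensity hQ (f := fun _ => (1 : ℝ)) measurable_const (memLp_const 1)
  have h3 := memLp_mul_rootDensity hP hm hh
  refine (((h2.sub h1).const_mul t⁻¹).sub (h3.const_mul (1 / 2))).ae_eq (.of_forall fun w => ?_)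
  simp only [qmdRemainder, Pi.sub_apply]
  ring

/-- Difference quotient of a linear functional: quantitative version. -/
lemma abs_diffQuotient_sub_le {P Q : Measure 𝒲} [IsProbabilityMeasure P] [IsProbabilityMeasure Q]
    {h h' f : 𝒲 → ℝ} (hm : Measurable h) (hh : MemLp h 2 P) (hm' : Measurable h') {K : ℝ}
    (hK : ∀ w, |h' w| ≤ K) (hfm : Measurable f) (hfP : MemLp f 2 P) (hfQ : MemLp f 2 Q)
    {t : ℝ} (ht : 0 < t) :
    |(∫ w, f w ∂Q - ∫ w, f w ∂P) / t - ∫ w, f w * h w ∂P| ≤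
      √(∫ w, qmdRemainder P Q h t w ^ 2 ∂(P + Q)) * (√(∫ w, f w ^ 2 ∂P) + √(∫ w, f w ^ 2 ∂Q))
      + (1 / 2 * (√(∫ w, (h w - h' w) ^ 2 ∂P) * (√(∫ w, f w ^ 2 ∂P) + √(∫ w, f w ^ 2 ∂Q)))
        + t * (1 / 2 * (√(∫ w, qmdRemainder P Q h t w ^ 2 ∂(P + Q)) * (K * √(∫ w, f w ^ 2 ∂P)))
          + 1 / 4 * (√(∫ w, h w ^ 2 ∂P) * (K * √(∫ w, f w ^ 2 ∂P))))) := by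
  have hP : P ≪ P + Q := Measure.absolutelyContinuous_of_le (Measure.le_add_right le_rfl)
  have hQ : Q ≪ P + Q := Measure.absolutelyContinuous_of_le (Measure.le_add_left le_rfl)
  set ν := P + Q with hν
  set sp := rootDensity P ν with hsp
  set sq := rootDensity Q ν with hsq
  set Δ := qmdRemainder P Q h t with hΔ
  -- The expansion √q - √p = t (Δ + h √p / 2); it is used below both for the factor √q - √p of q - p
  -- and once more for the second-order term.
  have hΔeq : ∀ w, sq w - sp w = t * (Δ w + 1 / 2 * (h w * sp w)) := by
    intro w
    have : Δ w = (sq w - sp w) / t - 1 / 2 * h w * sp w := rfl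
    rw [this]; field_simp; ring
  have hK0 : 0 ≤ K := (abs_nonneg _).trans (hK (Classical.choice
    (nonempty_of_isProbabilityMeasure P)))
  have mΔ : MemLp Δ 2 ν := memLp_qmdRemainder hm hh t
  have mfp : MemLp (fun w => f w * sp w) 2 ν := memLp_mul_rootDensity hP hfm hfP
  have mfq : MemLp (fun w => f w * sq w) 2 ν := memLp_mul_rootDensity hQ hfm hfQ
  have mhp : MemLp (fun w => h w * sp w) 2 ν := memLp_mul_rootDensity hP hm hh
  have mh'P : MemLp h' 2 P := MemLp.of_bound hm'.aestronglyMeasurable K (.of_forall hK)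
  have mdp : MemLp (fun w => (h w - h' w) * sp w) 2 ν :=
    memLp_mul_rootDensity hP (hm.sub hm') (hh.sub mh'P)
  have mfh' : MemLp (fun w => f w * h' w) 2 P := by
    refine (hfP.const_mul K).of_le (hfm.mul hm').aestronglyMeasurable (.of_forall fun w => ?_)
    simp only [norm_mul, Real.norm_eq_abs, abs_of_nonneg hK0]
    rw [mul_comm]
    exact mul_le_mul_of_nonneg_right (hK w) (abs_nonneg _)
  have mfhp : MemLp (fun w => (f w * h' w) * sp w) 2 ν :=
    memLp_mul_rootDensity hP (hfm.mul hm') mfh'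
  have nfh : √(∫ w, ((f w * h' w) * sp w) ^ 2 ∂ν) ≤ K * √(∫ w, f w ^ 2 ∂P) := by
    rw [sqrt_integral_mul_rootDensity hP (fun w => f w * h' w)]
    rw [← Real.sqrt_sq hK0, ← Real.sqrt_mul (sq_nonneg _), ← integral_const_mul]
    refine Real.sqrt_le_sqrt (integral_mono mfh'.integrable_sq (hfP.integrable_sq.const_mul _) ?_)
    intro w
    simp only [mul_pow]
    rw [mul_comm]
    refine mul_le_mul_of_nonneg_right ?_ (sq_nonneg _)
    rw [← sq_abs]
    exact pow_le_pow_left₀ (abs_nonneg _) (hK w) 2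
  have c1 := abs_integral_mul_le mΔ mfp
  have c2 := abs_integral_mul_le mΔ mfq
  have c3 := abs_integral_mul_le mdp mfp
  have c4 := abs_integral_mul_le mdp mfq
  have c5 := abs_integral_mul_le mΔ mfhp
  have c6 := abs_integral_mul_le mhp mfhp
  have i1 : Integrable (fun w => Δ w * (f w * sp w)) ν := mΔ.integrable_mul mfp
  have i2 : Integrable (fun w => Δ w * (f w * sq w)) ν := mΔ.integrable_mul mfq
  have i3 : Integrable (fun w => (h w - h' w) * sp w * (f w * sp w)) ν := mdp.integrable_mul mfp
  have i4 : Integrable (fun w => (h w - h' w) * sp w * (f w * sq w)) ν := mdp.integrable_mul mfq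
  have i5 : Integrable (fun w => Δ w * (f w * h' w * sp w)) ν := mΔ.integrable_mul mfhp
  have i6 : Integrable (fun w => (h w * sp w) * (f w * h' w * sp w)) ν := mhp.integrable_mul mfhp
  -- Since q - p = (√q - √p)(√q + √p), the error is f Δ (√p + √q) + (1/2) f h √p (√q - √p). In the
  -- last term h is split as (h - h') + h'. The first piece is small in L² as it stands. In the
  -- second, √q - √p is expanded again, which gains a factor t; this needs f h' √p in L², hence h'
  -- bounded.
  have key : (∫ w, f w ∂Q - ∫ w, f w ∂P) / t - ∫ w, f w * h w ∂P =
      ∫ w, Δ w * (f w * sp w) ∂ν + ∫ w, Δ w * (f w * sq w) ∂ν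
      + 1 / 2 * (∫ w, (h w - h' w) * sp w * (f w * sq w) ∂ν
          - ∫ w, (h w - h' w) * sp w * (f w * sp w) ∂ν)
      + t * (1 / 2 * ∫ w, Δ w * (f w * h' w * sp w) ∂ν
          + 1 / 4 * ∫ w, (h w * sp w) * (f w * h' w * sp w) ∂ν) := by
    rw [← integral_mul_rootDensity_sq hP f, ← integral_mul_rootDensity_sq hQ f,
      ← integral_mul_rootDensity_sq hP (fun w => f w * h w), ← integral_sub
        (integrable_mul_rootDensity_sq hQ (hfQ.integrable one_le_two))
        (integrable_mul_rootDensity_sq hP (hfP.integrable one_le_two)), ← integral_div,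
      ← integral_sub, ← integral_add i1 i2, ← integral_sub i4 i3, ← integral_const_mul,
      ← integral_const_mul, ← integral_const_mul, ← integral_add,
      ← integral_add (i5.const_mul (1 / 2)) (i6.const_mul (1 / 4)), ← integral_const_mul,
      ← integral_add]
    · refine integral_congr_ae (.of_forall fun w => ?_)
      have e := hΔeq w
      have e' : sq w = sp w + t * (Δ w + 1 / 2 * (h w * sp w)) := by linarith
      simp only [← hsp, ← hsq]
      rw [e']
      field_simp
      ring
    · exact (i1.add i2).add ((i4.sub i3).const_mul _)
    · exact ((i5.const_mul _).add (i6.const_mul _)).const_mul _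
    · exact i1.add i2
    · exact (i4.sub i3).const_mul _
    · exact ((integrable_mul_rootDensity_sq hQ (hfQ.integrable one_le_two)).sub
        (integrable_mul_rootDensity_sq hP (hfP.integrable one_le_two))).div_const t
    · exact integrable_mul_rootDensity_sq hP (hfP.integrable_mul hh)
  rw [sqrt_integral_mul_rootDensity hP f] at c1 c3
  rw [sqrt_integral_mul_rootDensity hQ f] at c2 c4
  rw [sqrt_integral_mul_rootDensity hP (fun w => h w - h' w)] at c3 c4
  rw [sqrt_integral_mul_rootDensity hP h] at c6
  have c5' := c5.trans (mul_le_mul_of_nonneg_left nfh (Real.sqrt_nonneg _))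
  have c6' := c6.trans (mul_le_mul_of_nonneg_left nfh (Real.sqrt_nonneg _))
  have h56 : |1 / 2 * ∫ w, Δ w * (f w * h' w * sp w) ∂ν
          + 1 / 4 * ∫ w, (h w * sp w) * (f w * h' w * sp w) ∂ν| ≤
      1 / 2 * (√(∫ w, Δ w ^ 2 ∂ν) * (K * √(∫ w, f w ^ 2 ∂P)))
          + 1 / 4 * (√(∫ w, h w ^ 2 ∂P) * (K * √(∫ w, f w ^ 2 ∂P))) := by
    rw [abs_le] at c5' c6' ⊢
    constructor <;> linarith [c5'.1, c5'.2, c6'.1, c6'.2]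
  have h56' := mul_le_mul_of_nonneg_left h56 ht.le
  rw [← abs_of_pos ht, ← abs_mul, abs_of_pos ht] at h56'
  rw [key]
  rw [abs_le] at c1 c2 c3 c4 h56' ⊢
  constructor <;>
    linarith [c1.1, c1.2, c2.1, c2.2, c3.1, c3.2, c4.1, c4.2, h56'.1, h56'.2]

lemma IsQMDPath.congr {P : Measure 𝒲} [IsFiniteMeasure P] {Q : ℝ → Measure 𝒲} {h h' : 𝒲 → ℝ}
    (hQ : IsQMDPath P Q h) (hfin : ∀ᶠ t in 𝓝[>] (0 : ℝ), IsFiniteMeasure (Q t))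
    (hh : h =ᵐ[P] h') : IsQMDPath P Q h' := by
  refine ⟨hQ.1, hQ.2.1.ae_eq hh, hQ.2.2.congr' ?_⟩
  filter_upwards [hfin] with t ht
  refine lintegral_congr_ae ?_
  filter_upwards [Measure.ae_rnDeriv_ne_zero_imp_of_ae (ν := P + Q t) hh] with w hw
  by_cases h0 : P.rnDeriv (P + Q t) w = 0
  · simp [h0]
  · rw [hw h0]

/-- Pathwise differentiability of a linear functional along submodels under which the integrand has
a bounded second moment. -/
lemma IsQMDPath.tendsto_diffQuotient {P : Measure 𝒲} [IsProbabilityMeasure P]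
    {Q : ℝ → Measure 𝒲} {h : 𝒲 → ℝ} (hQ : IsQMDPath P Q h)
    (hprob : ∀ᶠ t in 𝓝[>] (0 : ℝ), IsProbabilityMeasure (Q t))
    {f : 𝒲 → ℝ} (hfm : Measurable f) (hfP : MemLp f 2 P) (B : ℝ≥0)
    (hB : ∀ᶠ t in 𝓝[>] (0 : ℝ), ∫⁻ w, ENNReal.ofReal (f w ^ 2) ∂(Q t) ≤ B) :
    Tendsto (fun t : ℝ => (∫ w, f w ∂(Q t) - ∫ w, f w ∂P) / t) (𝓝[>] 0)
      (𝓝 (∫ w, f w * h w ∂P)) := by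
  -- The score matters only up to P-null sets, so a measurable representative may be used.
  wlog hm : Measurable h generalizing h
  · have hae := hQ.2.1.1.ae_eq_mk
    have h1 := this (hQ.congr (hprob.mono fun t ht => inferInstance) hae)
      hQ.2.1.1.stronglyMeasurable_mk.measurable
    have h2 : ∫ w, f w * h w ∂P = ∫ w, f w * hQ.2.1.1.mk h w ∂P :=
      integral_congr_ae (hae.mono fun w hw => by simp only [hw])
    rwa [h2]
  have hh := hQ.2.1
  set a := √(∫ w, f w ^ 2 ∂P) with ha
  set H := √(∫ w, h w ^ 2 ∂P) with hH
  have ha0 : 0 ≤ a := Real.sqrt_nonneg _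
  let D : ℝ → ℝ := fun t => √(∫ w, qmdRemainder P (Q t) h t w ^ 2 ∂(P + Q t))
  have hD : Tendsto D (𝓝[>] 0) (𝓝 0) := by
    have h1 : Tendsto (fun t : ℝ => √(∫⁻ w, ENNReal.ofReal
        (qmdRemainder P (Q t) h t w ^ 2) ∂(P + Q t)).toReal) (𝓝[>] 0) (𝓝 0) := by
      have := (Real.continuous_sqrt.tendsto 0).comp
        ((ENNReal.tendsto_toReal ENNReal.zero_ne_top).comp hQ.2.2)
      rw [Real.sqrt_zero] at this
      exact this
    refine h1.congr' ?_
    filter_upwards [hprob] with t ht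
    simp only [D]
    rw [integral_eq_lintegral_of_nonneg_ae (.of_forall fun w => sq_nonneg _)
      ((memLp_qmdRemainder hm hh t).1.aemeasurable.pow_const 2).aestronglyMeasurable]
  have hsmall : ∀ E > 0, ∀ᶠ t in 𝓝[>] (0 : ℝ),
      |(∫ w, f w ∂(Q t) - ∫ w, f w ∂P) / t - ∫ w, f w * h w ∂P| ≤ E := by
    intro E hE
    set b := √(B : ℝ) with hb
    have hb0 : 0 ≤ b := Real.sqrt_nonneg _
    -- As t ↓ 0 the quantitative bound tends to δ (a + b) / 2, where δ is the L² distance from h to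
    -- a simple function h'. The bound K of h' may blow up as δ shrinks, but it only enters
    -- multiplied by t, so h' is fixed before t tends to 0.
    set δ := E / (a + b + 1) with hδ
    have hδ0 : 0 < δ := by positivity
    obtain ⟨h', hh', -⟩ := hh.exists_simpleFunc_eLpNorm_sub_lt (by simp)
      (ε := ENNReal.ofReal δ) (by simpa using hδ0)
    obtain ⟨K, hK⟩ := h'.exists_forall_norm_le
    have hK0 : 0 ≤ K := (norm_nonneg _).trans (hK (Classical.choice
      (nonempty_of_isProbabilityMeasure P)))
    have hm' : MemLp (fun w => h w - h' w) 2 P :=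
      hh.sub (MemLp.of_bound h'.measurable.aestronglyMeasurable K (.of_forall hK))
    have hhδ : √(∫ w, (h w - h' w) ^ 2 ∂P) ≤ δ := by
      have e := hm'.eLpNorm_eq_integral_rpow_norm (by simp) (by simp)
      simp only [ENNReal.toReal_ofNat, Real.norm_eq_abs, Real.rpow_ofNat, sq_abs,
        ← one_div, ← Real.sqrt_eq_rpow] at e
      have := hh'.le
      rw [show (h - ⇑h') = fun w => h w - h' w from rfl, e] at this
      exact (ENNReal.ofReal_le_ofReal_iff hδ0.le).1 this
    have hlim : Tendsto (fun t : ℝ => D t * (a + b) + (1 / 2 * (δ * (a + b))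
        + t * (1 / 2 * (D t * (K * a)) + 1 / 4 * (H * (K * a))))) (𝓝[>] 0)
        (𝓝 (0 * (a + b) + (1 / 2 * (δ * (a + b))
        + 0 * (1 / 2 * (0 * (K * a)) + 1 / 4 * (H * (K * a)))))) := by
      have ht : Tendsto (fun t : ℝ => t) (𝓝[>] 0) (𝓝 0) := nhdsWithin_le_nhds
      exact (hD.mul_const _).add (tendsto_const_nhds.add (ht.mul
        (((hD.mul_const _).const_mul _).add tendsto_const_nhds)))
    have hlt : 0 * (a + b) + (1 / 2 * (δ * (a + b))
        + 0 * (1 / 2 * (0 * (K * a)) + 1 / 4 * (H * (K * a)))) < E := by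
      have : δ * (a + b + 1) = E := by rw [hδ]; field_simp
      nlinarith
    filter_upwards [hlim.eventually_lt_const hlt, hprob, hB, self_mem_nhdsWithin] with t h1 h2 h3 h4
    have hfQ : MemLp f 2 (Q t) := by
      rw [memLp_two_iff_integrable_sq hfm.aestronglyMeasurable]
      refine ⟨(hfm.pow_const 2).aestronglyMeasurable, ?_⟩
      rw [hasFiniteIntegral_iff_ofReal (.of_forall fun w => sq_nonneg _)]
      exact h3.trans_lt ENNReal.coe_lt_top
    have hfb : √(∫ w, f w ^ 2 ∂(Q t)) ≤ b := by
      refine Real.sqrt_le_sqrt ?_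
      rw [integral_eq_lintegral_of_nonneg_ae (.of_forall fun w => sq_nonneg _)
        (hfm.pow_const 2).aestronglyMeasurable]
      exact ENNReal.toReal_le_coe_of_le_coe h3
    refine (abs_diffQuotient_sub_le hm hh h'.measurable hK hfm hfP hfQ h4).trans (le_trans ?_ h1.le)
    have ht0 : (0 : ℝ) < t := h4
    gcongr
  rw [Metric.tendsto_nhds]
  intro ε hε
  filter_upwards [hsmall (ε / 2) (by positivity)] with t ht
  rw [Real.dist_eq]
  linarith

/-! ### Submodels with density 1 + t h -/

/-- The left side is exactly (√(1 + x) - 1)² / 2, and x = (√(1 + x) - 1)(√(1 + x) + 1) with second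
factor at least 1. -/
lemma abs_sqrt_one_add_sub_le {x : ℝ} (hx : -1 ≤ x) : |√(1 + x) - 1 - x / 2| ≤ x ^ 2 / 2 := by
  have hs := Real.sq_sqrt (show (0 : ℝ) ≤ 1 + x by linarith)
  have h0 := Real.sqrt_nonneg (1 + x)
  have e : √(1 + x) - 1 - x / 2 = -((√(1 + x) - 1) ^ 2 / 2) := by linarith
  rw [e, abs_neg, abs_of_nonneg (by positivity)]
  have : x = (√(1 + x) - 1) * (√(1 + x) + 1) := by linarith
  have h2 : x ^ 2 = (√(1 + x) - 1) ^ 2 * (√(1 + x) + 1) ^ 2 := by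
    conv_lhs => rw [this]
    ring
  rw [h2]
  nlinarith [sq_nonneg (√(1 + x) - 1), mul_nonneg (sq_nonneg (√(1 + x) - 1)) h0,
    mul_nonneg (sq_nonneg (√(1 + x) - 1)) (sq_nonneg √(1 + x))]

/-- The submodel with density `1 + t h` with respect to `P`. -/
noncomputable def linearPath (P : Measure 𝒲) (h : 𝒲 → ℝ) (t : ℝ) : Measure 𝒲 :=
  P.withDensity fun w => ENNReal.ofReal (1 + t * h w)

lemma eventually_one_add_mul_nonneg {P : Measure 𝒲} {h : 𝒲 → ℝ} {c : ℝ}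
    (hc : ∀ᵐ w ∂P, |h w| ≤ c) :
    ∀ᶠ t in 𝓝[>] (0 : ℝ), 0 < t ∧ t * c ≤ 1 ∧ ∀ᵐ w ∂P, |t * h w| ≤ t * c := by
  have ht : Tendsto (fun t : ℝ => t * c) (𝓝[>] 0) (𝓝 (0 * c)) :=
    (tendsto_id.mono_left nhdsWithin_le_nhds).mul_const c
  filter_upwards [ht.eventually_le_const (show 0 * c < 1 by simp), self_mem_nhdsWithin] with t h1 h2
  have h3 : (0 : ℝ) < t := h2
  refine ⟨h3, h1, hc.mono fun w hw => ?_⟩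
  rw [abs_mul, abs_of_pos h3]
  gcongr

lemma isProbabilityMeasure_linearPath {P : Measure 𝒲} [IsProbabilityMeasure P] {h : 𝒲 → ℝ}
    (hi : Integrable h P) (h0 : ∫ w, h w ∂P = 0) {t : ℝ} (ht : ∀ᵐ w ∂P, -1 ≤ t * h w) :
    IsProbabilityMeasure (linearPath P h t) := by
  have hi' : Integrable (fun w => 1 + t * h w) P := (integrable_const _).add (hi.const_mul t)
  refine ⟨?_⟩
  rw [linearPath, withDensity_apply _ .univ, Measure.restrict_univ,
    ← ofReal_integral_eq_lintegral_ofReal hi'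
      (ht.mono fun w hw => by simp only [Pi.zero_apply]; linarith),
    integral_add (integrable_const _) (hi.const_mul t), integral_const_mul, h0]
  simp

/-- The root density along the path is √(1 + t h) times that of P. The second-order expansion of the
square root bounds the remainder pointwise by t c² / 2 times the root density of P, where c is the
essential bound of h. -/
lemma isQMDPath_linearPath {P : Measure 𝒲} [IsProbabilityMeasure P] {h : 𝒲 → ℝ} {c : ℝ}
    (hm : Measurable h) (hc : ∀ᵐ w ∂P, |h w| ≤ c) (h0 : ∫ w, h w ∂P = 0) :
    IsQMDPath P (linearPath P h) h := by
  have hL : MemLp h 2 P := MemLp.of_bound hm.aestronglyMeasurable c hc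
  refine ⟨by simp [linearPath], hL, ?_⟩
  have hlim : Tendsto (fun t : ℝ => ENNReal.ofReal ((t * c ^ 2 / 2) ^ 2)) (𝓝[>] 0) (𝓝 0) := by
    have : Tendsto (fun t : ℝ => (t * c ^ 2 / 2) ^ 2) (𝓝[>] 0) (𝓝 ((0 * c ^ 2 / 2) ^ 2)) :=
      (((tendsto_id.mono_left nhdsWithin_le_nhds).mul_const _).div_const _).pow 2
    simpa using ENNReal.tendsto_ofReal this
  refine tendsto_of_tendsto_of_tendsto_of_le_of_le' tendsto_const_nhds hlim
    (.of_forall fun _ => zero_le) ?_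
  filter_upwards [eventually_one_add_mul_nonneg hc] with t ⟨ht0, ht1, ht⟩
  have hlow : ∀ᵐ w ∂P, -1 ≤ t * h w := ht.mono fun w hw => by linarith [(abs_le.1 hw).1]
  have := isProbabilityMeasure_linearPath (hL.integrable one_le_two) h0 hlow
  set ν := P + linearPath P h t with hν
  have hP : P ≪ ν := Measure.absolutelyContinuous_of_le (Measure.le_add_right le_rfl)
  have hd : (linearPath P h t).rnDeriv ν =ᵐ[ν]
      fun w => ENNReal.ofReal (1 + t * h w) * P.rnDeriv ν w :=
    Measure.rnDeriv_withDensity_left (by fun_prop) (.of_forall fun _ => ENNReal.ofReal_ne_top)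
  have hbound : ∀ᵐ w ∂ν, P.rnDeriv ν w ≠ 0 → |t * h w| ≤ t * c :=
    Measure.ae_rnDeriv_ne_zero_imp_of_ae (ν := ν) ht
  calc ∫⁻ w, ENNReal.ofReal (((Real.sqrt ((linearPath P h t).rnDeriv ν w).toReal
            - Real.sqrt (P.rnDeriv ν w).toReal) / t
          - 1 / 2 * h w * Real.sqrt (P.rnDeriv ν w).toReal) ^ 2) ∂ν
      ≤ ∫⁻ w, ENNReal.ofReal ((t * c ^ 2 / 2) ^ 2) * P.rnDeriv ν w ∂ν := by
        refine lintegral_mono_ae ?_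
        filter_upwards [hd, hbound, P.rnDeriv_lt_top ν] with w h1 h2 h3
        by_cases hz : P.rnDeriv ν w = 0
        · simp [h1, hz]
        have h4 := h2 hz
        have h5 : -1 ≤ t * h w := by linarith [(abs_le.1 h4).1]
        rw [h1, ENNReal.toReal_mul, ENNReal.toReal_ofReal (by linarith),
          Real.sqrt_mul (by linarith)]
        conv_rhs => rw [← ENNReal.ofReal_toReal h3.ne, ← ENNReal.ofReal_mul (sq_nonneg _)]
        refine ENNReal.ofReal_le_ofReal ?_
        have e : (√(1 + t * h w) * √(P.rnDeriv ν w).toReal - √(P.rnDeriv ν w).toReal) / t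
            - 1 / 2 * h w * √(P.rnDeriv ν w).toReal
            = ((√(1 + t * h w) - 1 - t * h w / 2) / t) * √(P.rnDeriv ν w).toReal := by
          field_simp
        rw [e, mul_pow, Real.sq_sqrt ENNReal.toReal_nonneg]
        refine mul_le_mul_of_nonneg_right ?_ ENNReal.toReal_nonneg
        rw [← sq_abs]
        refine pow_le_pow_left₀ (abs_nonneg _) ?_ 2
        rw [abs_div, abs_of_pos ht0, div_le_iff₀ ht0]
        refine (abs_sqrt_one_add_sub_le h5).trans ?_
        have h6 : (t * h w) ^ 2 ≤ (t * c) ^ 2 := by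
          rw [← sq_abs]; exact pow_le_pow_left₀ (abs_nonneg _) h4 2
        nlinarith
    _ = ENNReal.ofReal ((t * c ^ 2 / 2) ^ 2) := by
        rw [lintegral_const_mul _ (Measure.measurable_rnDeriv P ν),
          Measure.lintegral_rnDeriv hP]
        simp

lemma integral_linearPath {P : Measure 𝒲} {h : 𝒲 → ℝ} (hm : Measurable h) {t : ℝ}
    (ht : ∀ᵐ w ∂P, -1 ≤ t * h w) (f : 𝒲 → ℝ) :
    ∫ w, f w ∂(linearPath P h t) = ∫ w, (1 + t * h w) * f w ∂P := by
  rw [linearPath, integral_withDensity_eq_integral_toReal_smul (by fun_prop)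
    (.of_forall fun _ => ENNReal.ofReal_lt_top)]
  refine integral_congr_ae (ht.mono fun w hw => ?_)
  simp only [smul_eq_mul]
  rw [ENNReal.toReal_ofReal (by linarith)]

end Semiparametric

/-! ### Conditional expectations and conditional probabilities of annotation -/

lemma integral_mul_condExp {Ω : Type*} {m m₀ : MeasurableSpace Ω} (hm : m ≤ m₀) {μ : Measure Ω}
    [IsFiniteMeasure μ] {k f : Ω → ℝ} (hk : StronglyMeasurable[m] k)
    (hkf : Integrable (fun ω => k ω * f ω) μ) (hf : Integrable f μ) :
    ∫ ω, k ω * (μ[f | m]) ω ∂μ = ∫ ω, k ω * f ω ∂μ := by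
  have h := condExp_mul_of_stronglyMeasurable_left (μ := μ) hk hkf hf
  have h2 := integral_condExp (μ := μ) (f := k * f) hm
  rw [integral_congr_ae h] at h2
  exact h2

namespace DiD

lemma ind_true : ind true = 1 := rfl

lemma ind_nonneg (b : Bool) : 0 ≤ ind b := by cases b <;> simp [ind]

lemma ind_le_one (b : Bool) : ind b ≤ 1 := by cases b <;> simp [ind]

lemma ind_mul_self (b : Bool) : ind b * ind b = ind b := by cases b <;> simp [ind]

@[fun_prop]
lemma measurable_ind : Measurable ind := Measurable.of_discrete

section Score

variable {Ω β γ : Type*} [MeasurableSpace Ω] [MeasurableSpace β] [MeasurableSpace γ]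

/-- `p` is the conditional probability of the event `A` given `V`. -/
def HasScore (μ : Measure Ω) (A : Ω → Bool) (V : Ω → β) (p : β → ℝ) : Prop :=
  (μ.restrict {ω | A ω = true}).map V = (μ.map V).withDensity fun v => ENNReal.ofReal (p v)

lemma measurableSet_eq_true {A : Ω → Bool} (hA : Measurable A) :
    MeasurableSet {ω | A ω = true} := hA (measurableSet_singleton true)

lemma integral_ind_mul {μ : Measure Ω} {A : Ω → Bool} (hA : Measurable A) (f : Ω → ℝ) :
    ∫ ω, ind (A ω) * f ω ∂μ = ∫ ω in {ω | A ω = true}, f ω ∂μ := by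
  rw [← integral_indicator (measurableSet_eq_true hA)]
  refine integral_congr_ae (.of_forall fun ω => ?_)
  by_cases h : A ω = true <;> simp [ind, h, Set.indicator]

lemma integrable_ind_mul {μ : Measure Ω} {A : Ω → Bool} (hA : Measurable A) (f : Ω → ℝ) :
    Integrable (fun ω => ind (A ω) * f ω) μ ↔ Integrable f (μ.restrict {ω | A ω = true}) := by
  rw [← IntegrableOn, ← integrable_indicator_iff (measurableSet_eq_true hA)]
  refine integrable_congr (.of_forall fun ω => ?_)
  by_cases h : A ω = true <;> simp [ind, h, Set.indicator]

/-- The score is defined as an identity between laws of `V`, so integrating `f` against both sides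
needs no integrability of `f`. -/
lemma HasScore.integral_eq {μ : Measure Ω} {A : Ω → Bool} {V : Ω → β} {p : β → ℝ}
    (h : HasScore μ A V p) (hA : Measurable A) (hV : Measurable V) (hp : Measurable p)
    (hp0 : ∀ v, 0 ≤ p v) {f : β → ℝ} (hf : Measurable f) :
    ∫ ω, ind (A ω) * f (V ω) ∂μ = ∫ ω, p (V ω) * f (V ω) ∂μ := by
  rw [integral_ind_mul hA, ← integral_map hV.aemeasurable hf.aestronglyMeasurable, h,
    integral_withDensity_eq_integral_toReal_smul (by fun_prop)
      (.of_forall fun _ => ENNReal.ofReal_lt_top)]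
  simp only [smul_eq_mul, ENNReal.toReal_ofReal (hp0 _)]
  exact integral_map hV.aemeasurable (hp.mul hf).aestronglyMeasurable

lemma HasScore.integrable_iff {μ : Measure Ω} {A : Ω → Bool} {V : Ω → β} {p : β → ℝ}
    (h : HasScore μ A V p) (hA : Measurable A) (hV : Measurable V) (hp : Measurable p)
    (hp0 : ∀ v, 0 ≤ p v) {f : β → ℝ} (hf : Measurable f) :
    Integrable (fun ω => ind (A ω) * f (V ω)) μ ↔ Integrable (fun ω => p (V ω) * f (V ω)) μ := by
  rw [integrable_ind_mul hA]
  change Integrable (f ∘ V) _ ↔ Integrable ((fun v => p v * f v) ∘ V) _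
  rw [← integrable_map_measure hf.aestronglyMeasurable hV.aemeasurable,
    ← integrable_map_measure (g := fun v => p v * f v) (hp.mul hf).aestronglyMeasurable hV.aemeasurable, h,
    integrable_withDensity_iff_integrable_smul' (by fun_prop)
      (.of_forall fun _ => ENNReal.ofReal_lt_top)]
  simp only [smul_eq_mul, ENNReal.toReal_ofReal (hp0 _)]

lemma hasScore_iff {μ : Measure Ω} [IsFiniteMeasure μ] {A : Ω → Bool} {V : Ω → β} {p : β → ℝ}
    (hA : Measurable A) (hV : Measurable V) (hp : Measurable p) (hp0 : ∀ v, 0 ≤ p v)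
    (hpi : Integrable (fun ω => p (V ω)) μ) :
    HasScore μ A V p ↔ ∀ B, MeasurableSet B →
      ∫ ω in V ⁻¹' B, p (V ω) ∂μ = ∫ ω in V ⁻¹' B, ind (A ω) ∂μ := by
  have hA' := measurableSet_eq_true hA
  have e1 : ∀ B, MeasurableSet B → ((μ.restrict {ω | A ω = true}).map V) B
      = ENNReal.ofReal (∫ ω in V ⁻¹' B, ind (A ω) ∂μ) := by
    intro B hB
    have : (fun ω => ind (A ω)) = fun ω => ind (A ω) * (1 : ℝ) := by simp
    rw [this, integral_ind_mul hA, Measure.map_apply hV hB, Measure.restrict_restrict hA',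
      Measure.restrict_apply (hV hB)]
    simp [Set.inter_comm]
  have e2 : ∀ B, MeasurableSet B → ((μ.map V).withDensity fun v => ENNReal.ofReal (p v)) B
      = ENNReal.ofReal (∫ ω in V ⁻¹' B, p (V ω) ∂μ) := by
    intro B hB
    rw [withDensity_apply _ hB, ofReal_integral_eq_lintegral_ofReal hpi.integrableOn
      (.of_forall fun _ => hp0 _), setLIntegral_map hB (by fun_prop) hV]
  constructor
  · intro h B hB
    have h1 := e1 B hB
    rw [h, e2 B hB] at h1
    exact (ENNReal.ofReal_eq_ofReal_iff (integral_nonneg fun _ => hp0 _)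
      (integral_nonneg fun _ => ind_nonneg _)).1 h1
  · intro h
    refine Measure.ext fun B hB => ?_
    rw [e1 B hB, e2 B hB, h B hB]

lemma integrable_ind_comp {μ : Measure Ω} [IsFiniteMeasure μ] {A : Ω → Bool} (hA : Measurable A) :
    Integrable (fun ω => ind (A ω)) μ :=
  Integrable.of_bound (measurable_ind.comp hA).aestronglyMeasurable 1
    (.of_forall fun ω => by
      rw [Real.norm_eq_abs, abs_of_nonneg (ind_nonneg _)]; exact ind_le_one _)

/-- Links the identity of measures, which is convenient for change of variables, with the
conditional expectation used in the assumptions and in the model. -/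
lemma hasScore_iff_condExp {μ : Measure Ω} [IsFiniteMeasure μ] {A : Ω → Bool} {V : Ω → β}
    {p : β → ℝ} (hA : Measurable A) (hV : Measurable V) (hp : Measurable p) (hp0 : ∀ v, 0 ≤ p v)
    (hpi : Integrable (fun ω => p (V ω)) μ) :
    HasScore μ A V p ↔
      μ[fun ω => ind (A ω) | MeasurableSpace.comap V inferInstance] =ᵐ[μ] fun ω => p (V ω) := by
  rw [hasScore_iff hA hV hp hp0 hpi]
  constructor
  · intro h
    refine (ae_eq_condExp_of_forall_setIntegral_eq hV.comap_le (integrable_ind_comp hA)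
      (fun s _ _ => hpi.integrableOn) ?_ ?_).symm
    · rintro _ ⟨B, hB, rfl⟩ -
      exact h B hB
    · exact (hp.comp (comap_measurable V)).stronglyMeasurable.aestronglyMeasurable
  · intro h B hB
    rw [← setIntegral_condExp hV.comap_le (integrable_ind_comp hA) ⟨B, hB, rfl⟩]
    exact setIntegral_congr_ae (hV hB) (h.mono fun ω hω _ => hω.symm)

/-- A density that factors through `u` survives the push-forward along `u`: conditioning on less
keeps the score when the score depends on the retained variables only. -/
lemma HasScore.comp {μ : Measure Ω} {A : Ω → Bool} {V : Ω → β} {u : β → γ} {p : γ → ℝ}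
    (h : HasScore μ A V (fun v => p (u v))) (hV : Measurable V) (hu : Measurable u)
    (hp : Measurable p) : HasScore μ A (fun ω => u (V ω)) p := by
  have h' := congrArg (Measure.map u) h
  rw [Measure.map_map hu hV] at h'
  change (μ.restrict {ω | A ω = true}).map (u ∘ V) = (μ.map (u ∘ V)).withDensity _
  rw [h', ← Measure.map_map hu hV]
  refine Measure.ext fun B hB => ?_
  rw [Measure.map_apply hu hB, withDensity_apply _ (hu hB), withDensity_apply _ hB,
    setLIntegral_map hB (by fun_prop) hu]

lemma hasScore_map_iff {μ : Measure Ω} {T : Ω → γ} (hT : Measurable T) {A : γ → Bool} {V : γ → β}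
    {p : β → ℝ} (hA : Measurable A) (hV : Measurable V) :
    HasScore (μ.map T) A V p ↔ HasScore μ (fun ω => A (T ω)) (fun ω => V (T ω)) p := by
  unfold HasScore
  rw [Measure.restrict_map hT (measurableSet_eq_true hA), Measure.map_map hV hT,
    Measure.map_map hV hT]
  rfl

/-- If `p(Z)` is the conditional probability of `A` given `Z`, and `V ⟂ A ∣ Z`, then it is the
conditional probability of `A` given `(Z, V)`. -/
lemma hasScore_prodMk_of_condIndepFun [StandardBorelSpace Ω] {μ : Measure Ω} [IsFiniteMeasure μ]
    {A : Ω → Bool} {Z : Ω → β} {V : Ω → γ} {p : β → ℝ} (hA : Measurable A) (hZ : Measurable Z)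
    (hV : Measurable V) (hp : Measurable p) (hp0 : ∀ z, 0 ≤ p z) (hp1 : ∀ z, p z ≤ 1)
    (hscore : HasScore μ A Z p)
    (hind : CondIndepFun (MeasurableSpace.comap Z inferInstance) hZ.comap_le V A μ) :
    HasScore μ A (fun ω => (Z ω, V ω)) (fun v => p v.1) := by
  have hpi : Integrable (fun ω => p (Z ω)) μ :=
    Integrable.of_bound (hp.comp hZ).aestronglyMeasurable 1 (.of_forall fun ω => by
      rw [Real.norm_eq_abs, abs_of_nonneg (hp0 _)]; exact hp1 _)
  have hA' := measurableSet_eq_true hA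
  -- Two finite measures on a product that agree on rectangles are equal.
  refine Measure.ext_prod fun {s t} hs ht => ?_
  have hpre : (fun ω => (Z ω, V ω)) ⁻¹' (s ×ˢ t) = Z ⁻¹' s ∩ V ⁻¹' t := rfl
  have hscore' := (hasScore_iff_condExp hA hZ hp hp0 hpi).1 hscore
  have hindA : ((A ⁻¹' {true}).indicator fun _ => (1 : ℝ)) = fun ω => ind (A ω) := by
    ext ω
    by_cases h : A ω = true <;> simp [ind, h, Set.indicator]
  have h1 := (condIndepFun_iff_condExp_inter_preimage_eq_mul hV hA).1 hind t {true} ht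
    (measurableSet_singleton true)
  rw [hindA] at h1
  have hit : Integrable ((V ⁻¹' t).indicator fun _ => (1 : ℝ)) μ :=
    (integrable_const 1).indicator (hV ht)
  have hpit : Integrable (fun ω => p (Z ω) * (V ⁻¹' t).indicator (fun _ => (1 : ℝ)) ω) μ := by
    refine (hpi.indicator (hV ht)).congr (.of_forall fun ω => ?_)
    by_cases h : ω ∈ V ⁻¹' t <;> simp [h]
  have h2 := condExp_mul_of_stronglyMeasurable_left (μ := μ)
    (hp.comp (comap_measurable Z)).stronglyMeasurable hpit hit
  -- By conditional independence E[1_t(V) 1_A | Z] = E[1_t(V) | Z] p(Z), which is E[p(Z) 1_t(V) | Z]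
  -- since p(Z) is known given Z.
  have h3 : ∫ ω in Z ⁻¹' s, (V ⁻¹' t ∩ A ⁻¹' {true}).indicator (fun _ => (1 : ℝ)) ω ∂μ
      = ∫ ω in Z ⁻¹' s, p (Z ω) * (V ⁻¹' t).indicator (fun _ => (1 : ℝ)) ω ∂μ := by
    rw [← setIntegral_condExp hZ.comap_le ((integrable_const 1).indicator ((hV ht).inter hA'))
      ⟨s, hs, rfl⟩, ← setIntegral_condExp hZ.comap_le hpit ⟨s, hs, rfl⟩]
    refine setIntegral_congr_ae (hZ hs) ?_
    filter_upwards [h1, h2, hscore'] with ω a1 a2 a3 _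
    rw [a1, a3]
    refine Eq.trans ?_ a2.symm
    simp only [Pi.mul_apply, Function.comp_apply]
    ring
  rw [setIntegral_indicator ((hV ht).inter (hA (measurableSet_singleton true)))] at h3
  have h4 : (fun ω => p (Z ω) * (V ⁻¹' t).indicator (fun _ => (1 : ℝ)) ω)
      = (V ⁻¹' t).indicator fun ω => p (Z ω) := by
    ext ω
    by_cases h : ω ∈ V ⁻¹' t <;> simp [h]
  rw [h4, setIntegral_indicator (hV ht)] at h3
  have hZV := (hZ.prodMk hV)
  rw [Measure.map_apply hZV (hs.prod ht), hpre, Measure.restrict_apply ((hZ hs).inter (hV ht)),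
    withDensity_apply _ (hs.prod ht), setLIntegral_map (hs.prod ht) (by fun_prop) hZV, hpre,
    ← ofReal_integral_eq_lintegral_ofReal hpi.integrableOn (.of_forall fun _ => hp0 _), ← h3]
  simp only [integral_const, smul_eq_mul, mul_one, Measure.real, Measure.restrict_apply_univ]
  rw [ENNReal.ofReal_toReal (measure_ne_top _ _), ← Set.inter_assoc]
  rfl

end Score

end DiD

/-! ### Groups, strata and inverse probability weighting -/

namespace DiD

section Cond

variable {Ω : Type*} [MeasurableSpace Ω]

lemma setIntegral_eq_mul_integral_cond (Q : Measure Ω) [IsFiniteMeasure Q] (S : Set Ω)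
    (f : Ω → ℝ) : ∫ w in S, f w ∂Q = Q.real S * ∫ w, f w ∂Q[|S] := by
  rw [ProbabilityTheory.cond, integral_smul_measure]
  -- On a null set the restricted measure is zero, so its rescaling by the inverse mass ∞ is still
  -- zero and both sides vanish.
  by_cases h : Q S = 0
  · rw [Measure.restrict_eq_zero.2 h, Measure.real, h]; simp
  · rw [ENNReal.toReal_inv, smul_eq_mul, ← mul_assoc, Measure.real,
      mul_inv_cancel₀ (ENNReal.toReal_ne_zero.2 ⟨h, measure_ne_top _ _⟩), one_mul]

lemma integrable_cond_iff (Q : Measure Ω) [IsFiniteMeasure Q] (S : Set Ω) (f : Ω → ℝ) :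
    Integrable f Q[|S] ↔ IntegrableOn f S Q := by
  rw [ProbabilityTheory.cond]
  by_cases h : Q S = 0
  · rw [IntegrableOn, Measure.restrict_eq_zero.2 h]; simp
  · exact integrable_smul_measure (ENNReal.inv_ne_zero.2 (measure_ne_top _ _))
      (ENNReal.inv_ne_top.2 h)

lemma memLp_cond (Q : Measure Ω) [IsFiniteMeasure Q] (S : Set Ω) {f : Ω → ℝ} {p : ℝ≥0∞}
    (hf : MemLp f p Q) : MemLp f p Q[|S] := by
  by_cases h : Q S = 0
  · simp [ProbabilityTheory.cond, Measure.restrict_eq_zero.2 h]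
  · exact (hf.restrict S).smul_measure (ENNReal.inv_ne_top.2 h)

end Cond

variable {k l : ℕ}

namespace Obs

@[fun_prop]
lemma measurable_M : Measurable (M : Obs k l → ℝ) := by unfold M; fun_prop

@[fun_prop]
lemma measurable_G : Measurable (G : Obs k l → Bool) :=
  (Measurable.of_discrete (f := cohort)).comp (measurable_fst.comp measurable_snd)

@[fun_prop]
lemma measurable_C : Measurable (C : Obs k l → Bool) :=
  (Measurable.of_discrete (f := never)).comp (measurable_fst.comp measurable_snd)

@[fun_prop]
lemma measurable_A : Measurable (A : Obs k l → Bool) :=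
  (Measurable.of_discrete (f := both)).comp
    (measurable_fst.comp (measurable_snd.comp measurable_snd))

@[fun_prop]
lemma measurable_X : Measurable (X : Obs k l → _) := by unfold X; fun_prop

@[fun_prop]
lemma measurable_feat : Measurable (feat : Obs k l → _) := by unfold feat; fun_prop

/-- The features together with the group indicators. -/
def strata (w : Obs k l) : Feat k l × Bool × Bool := (w.feat, w.G, w.C)

@[fun_prop]
lemma measurable_strata : Measurable (strata : Obs k l → _) := by unfold strata; fun_prop

end Obs

/-- `g` is the group of units with `(G, C) = e`. -/
def IsGroup (g : Obs k l → Bool) (e : Bool × Bool) : Prop :=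
  ∀ w, g w = decide ((w.G, w.C) = e)

/-- The two groups are disjoint, so membership in one determines both indicators. Coding a group as
one value of (G, C) lets every later estimate treat G and C at once. -/
lemma isGroup_G : IsGroup (Obs.G : Obs k l → Bool) (true, false) := by
  have h : ∀ d, cohort d = decide ((cohort d, never d) = (true, false)) := by decide
  exact fun w => h w.2.1

lemma isGroup_C : IsGroup (Obs.C : Obs k l → Bool) (false, true) := by
  have h : ∀ d, never d = decide ((cohort d, never d) = (false, true)) := by decide
  exact fun w => h w.2.1

/-- The indicator of the group `e` as a function of the strata. -/
def sel (e : Bool × Bool) (v : Feat k l × Bool × Bool) : ℝ := ind (decide (v.2 = e))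

@[fun_prop]
lemma measurable_sel (e : Bool × Bool) : Measurable (sel e : Feat k l × Bool × Bool → ℝ) :=
  (Measurable.of_discrete (f := fun b : Bool × Bool => ind (decide (b = e)))).comp measurable_snd

lemma IsGroup.sel_strata {g : Obs k l → Bool} {e : Bool × Bool} (hg : IsGroup g e) (w : Obs k l) :
    sel e w.strata = ind (g w) := by rw [hg w]; rfl

lemma IsGroup.measurable {g : Obs k l → Bool} {e : Bool × Bool} (hg : IsGroup g e) :
    Measurable g := by
  have : g = fun w => decide ((w.G, w.C) = e) := funext hg
  rw [this]
  exact (Measurable.of_discrete (f := fun b : Bool × Bool => decide (b = e))).comp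
    (Obs.measurable_G.prodMk Obs.measurable_C)

lemma IsGroup.strata_eq {g : Obs k l → Bool} {e : Bool × Bool} (hg : IsGroup g e) {w : Obs k l}
    (hw : g w = true) : w.strata = (w.feat, e) := by
  rw [hg w, decide_eq_true_eq] at hw
  simp [Obs.strata, ← hw]

/-- The annotated units of a group. -/
def annotated (g : Obs k l → Bool) : Set (Obs k l) := {w | g w = true ∧ w.A = true}

lemma measurableSet_annotated {g : Obs k l → Bool} (hg : Measurable g) :
    MeasurableSet (annotated g) :=
  (measurableSet_eq_true hg).inter (measurableSet_eq_true Obs.measurable_A)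

lemma ind_mul_ind_A (g : Obs k l → Bool) (f : Obs k l → ℝ) :
    (fun w => ind (g w) * (ind w.A * f w)) = (annotated g).indicator f := by
  ext w
  by_cases h : g w = true <;> by_cases h' : w.A = true <;>
    simp [ind, h, h', annotated, Set.indicator]

lemma integral_annotated {g : Obs k l → Bool} (hg : Measurable g) (Q : Measure (Obs k l))
    [IsFiniteMeasure Q] (f : Obs k l → ℝ) :
    ∫ w, ind (g w) * (ind w.A * f w) ∂Q
      = Q.real (annotated g) * ∫ w, f w ∂Q[|annotated g] := by
  rw [ind_mul_ind_A, integral_indicator (measurableSet_annotated hg),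
    setIntegral_eq_mul_integral_cond]

lemma integrable_annotated {g : Obs k l → Bool} (hg : Measurable g) (Q : Measure (Obs k l))
    [IsFiniteMeasure Q] (f : Obs k l → ℝ) :
    Integrable (fun w => ind (g w) * (ind w.A * f w)) Q ↔ Integrable f Q[|annotated g] := by
  rw [ind_mul_ind_A, integrable_indicator_iff (measurableSet_annotated hg), integrable_cond_iff]

lemma ae_cond_annotated {g : Obs k l → Bool} (hg : Measurable g) (Q : Measure (Obs k l)) :
    ∀ᵐ w ∂Q[|annotated g], g w = true ∧ w.A = true := by
  rw [ProbabilityTheory.cond]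
  exact Measure.ae_smul_measure (ae_restrict_mem (measurableSet_annotated hg)) _

/-- The conditional mean of `Y` given the features among annotated units, weighted. -/
lemma integral_annotated_mul_regression {g : Obs k l → Bool} (hg : Measurable g)
    (Q : Measure (Obs k l)) [IsFiniteMeasure Q] {Y : Obs k l → ℝ}
    (hY : Integrable Y Q[|annotated g]) {r : Feat k l → ℝ}
    (hr : (fun w => r w.feat) =ᵐ[Q[|annotated g]]
      (Q[|annotated g])[Y | MeasurableSpace.comap Obs.feat inferInstance])
    {u : Feat k l → ℝ} (hu : Measurable u) {c : ℝ} (hc : ∀ x, |u x| ≤ c) :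
    ∫ w, ind (g w) * (ind w.A * (u w.feat * r w.feat)) ∂Q
      = ∫ w, ind (g w) * (ind w.A * (u w.feat * Y w)) ∂Q := by
  have h := integral_mul_condExp Obs.measurable_feat.comap_le
    (hu.comp (comap_measurable Obs.feat)).stronglyMeasurable
    (hY.bdd_mul (hu.comp Obs.measurable_feat).aestronglyMeasurable (.of_forall fun w => hc w.feat))
    hY
  simp only [Function.comp_apply] at h
  rw [integral_annotated hg, integral_annotated hg, ← h]
  congr 1
  exact integral_congr_ae (hr.mono fun w hw => by simp only [hw])

/-- An annotation score bounded away from zero. -/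
structure Overlap (π : (Fin 2 → Fin k → ℝ) → ℝ) (η : ℝ) : Prop where
  measurable : Measurable π
  pos : 0 < η
  le : ∀ x, η ≤ π x
  le_one : ∀ x, π x ≤ 1

/-- In the model, `π` is the conditional probability of annotation given the strata. -/
def Scored (π : (Fin 2 → Fin k → ℝ) → ℝ) (Q : Measure (Obs k l)) : Prop :=
  HasScore Q Obs.A Obs.strata fun v => π v.1.1

section Overlap

variable {π : (Fin 2 → Fin k → ℝ) → ℝ} {η : ℝ}

lemma Overlap.pos' (hπ : Overlap π η) (x) : 0 < π x := hπ.pos.trans_le (hπ.le x)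

lemma Overlap.abs_inv_le (hπ : Overlap π η) (x) : |(π x)⁻¹| ≤ η⁻¹ := by
  rw [abs_of_pos (inv_pos.2 (hπ.pos' x))]
  exact inv_anti₀ hπ.pos (hπ.le x)

lemma Overlap.integrable_score (hπ : Overlap π η) (Q : Measure (Obs k l)) [IsFiniteMeasure Q] :
    Integrable (fun w : Obs k l => π w.X) Q :=
  Integrable.of_bound (hπ.measurable.comp Obs.measurable_X).aestronglyMeasurable 1
    (.of_forall fun w => by
      rw [Real.norm_eq_abs, abs_of_pos (hπ.pos' _)]; exact hπ.le_one _)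

lemma Overlap.measurable_strata (hπ : Overlap π η) :
    Measurable fun v : Feat k l × Bool × Bool => π v.1.1 := by
  have := hπ.measurable
  fun_prop

lemma scored_iff (hπ : Overlap π η) (Q : Measure (Obs k l)) [IsFiniteMeasure Q] :
    Scored π Q ↔ Q[fun w => ind w.A | MeasurableSpace.comap
        (fun w : Obs k l => (w.feat, w.G, w.C)) inferInstance] =ᵐ[Q] fun w => π w.X :=
  hasScore_iff_condExp Obs.measurable_A Obs.measurable_strata hπ.measurable_strata
    (fun v => (hπ.pos' v.1.1).le) (hπ.integrable_score Q)

variable {Q : Measure (Obs k l)}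

lemma Scored.integral_ind_mul (hQ : Scored π Q) (hπ : Overlap π η)
    {f : Feat k l × Bool × Bool → ℝ} (hf : Measurable f) :
    ∫ w, ind w.A * f w.strata ∂Q = ∫ w, π w.X * f w.strata ∂Q :=
  HasScore.integral_eq hQ Obs.measurable_A Obs.measurable_strata hπ.measurable_strata
    (fun v => (hπ.pos' v.1.1).le) hf

/-- Inverse probability weighting. -/
lemma Scored.integral_ipw (hQ : Scored π Q) (hπ : Overlap π η)
    {f : Feat k l × Bool × Bool → ℝ} (hf : Measurable f) :
    ∫ w, ind w.A * ((π w.X)⁻¹ * f w.strata) ∂Q = ∫ w, f w.strata ∂Q := by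
  have h := hQ.integral_ind_mul hπ (hπ.measurable_strata.inv.mul hf)
  refine h.trans (integral_congr_ae (.of_forall fun w => ?_))
  have := (hπ.pos' w.X).ne'
  simp only [Pi.mul_apply, Pi.inv_apply]
  change π w.X * ((π w.X)⁻¹ * _) = _
  field_simp

lemma Scored.integrable_ipw (hQ : Scored π Q) (hπ : Overlap π η)
    {f : Feat k l × Bool × Bool → ℝ} (hf : Measurable f) :
    Integrable (fun w => ind w.A * ((π w.X)⁻¹ * f w.strata)) Q
      ↔ Integrable (fun w => f w.strata) Q := by
  have h := HasScore.integrable_iff hQ Obs.measurable_A Obs.measurable_strata hπ.measurable_strata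
    (fun v => (hπ.pos' v.1.1).le) (hπ.measurable_strata.inv.mul hf)
  refine h.trans (integrable_congr (.of_forall fun w => ?_))
  have := (hπ.pos' w.X).ne'
  simp only [Pi.mul_apply, Pi.inv_apply]
  change π w.X * ((π w.X)⁻¹ * _) = _
  field_simp

variable {g : Obs k l → Bool} {e : Bool × Bool}

/-- The mean of the regression over a group, by inverse probability weighting. -/
lemma Scored.integral_group_mul_regression [IsFiniteMeasure Q] (hQ : Scored π Q)
    (hπ : Overlap π η) (hg : IsGroup g e) {Y : Obs k l → ℝ} (hY : Integrable Y Q[|annotated g])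
    {r : Feat k l → ℝ} (hrm : Measurable r) (hr : (fun w => r w.feat) =ᵐ[Q[|annotated g]]
      (Q[|annotated g])[Y | MeasurableSpace.comap Obs.feat inferInstance]) :
    ∫ w, ind (g w) * r w.feat ∂Q = ∫ w, ind (g w) * (ind w.A * ((π w.X)⁻¹ * Y w)) ∂Q := by
  -- The regression is a function of the strata, so the weight A/π may be inserted; among annotated
  -- units of the group it may then be exchanged for Y, because 1/π is a bounded function of the
  -- features.
  have h1 := hQ.integral_ipw hπ (f := fun v => sel e v * r v.1) (by fun_prop)
  simp only [hg.sel_strata] at h1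
  have h2 := integral_annotated_mul_regression hg.measurable Q hY hr
    (u := fun x => (π x.1)⁻¹) (hπ.measurable.comp measurable_fst).inv fun x => hπ.abs_inv_le x.1
  refine h1.symm.trans (Eq.trans ?_ h2)
  refine integral_congr_ae (.of_forall fun w => ?_)
  change ind w.A * ((π w.X)⁻¹ * (ind (g w) * r w.feat))
    = ind (g w) * (ind w.A * ((π w.X)⁻¹ * r w.feat))
  ring

/-- The regression is controlled only on annotated units. Inverse weighting carries its square over
the whole group back to those units, where conditional expectation contracts L² and 1/π is at most
1/η. -/
lemma Scored.memLp_group_mul_regression [IsFiniteMeasure Q] (hQ : Scored π Q)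
    (hπ : Overlap π η) (hg : IsGroup g e) {Y : Obs k l → ℝ} (hY : MemLp Y 2 Q[|annotated g])
    {r : Feat k l → ℝ} (hrm : Measurable r) (hr : (fun w => r w.feat) =ᵐ[Q[|annotated g]]
      (Q[|annotated g])[Y | MeasurableSpace.comap Obs.feat inferInstance]) :
    MemLp (fun w => ind (g w) * r w.feat) 2 Q := by
  have hgm := hg.measurable
  rw [memLp_two_iff_integrable_sq (by fun_prop)]
  have h1 := hQ.integrable_ipw hπ (f := fun v => (sel e v * r v.1) ^ 2) (by fun_prop)
  simp only [hg.sel_strata] at h1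
  refine h1.1 ?_
  have h2 : MemLp (fun w => r w.feat) 2 Q[|annotated g] :=
    (hY.condExp one_le_two).ae_eq hr.symm
  have h3 : Integrable (fun w => (π w.X)⁻¹ * r w.feat ^ 2) Q[|annotated g] :=
    h2.integrable_sq.bdd_mul (c := η⁻¹)
      (hπ.measurable.comp Obs.measurable_X).inv.aestronglyMeasurable
      (.of_forall fun w => hπ.abs_inv_le _)
  refine ((integrable_annotated hgm Q _).2 h3).congr (.of_forall fun w => ?_)
  simp only [mul_pow, sq (ind (g w)), ind_mul_self]
  change ind (g w) * (ind w.A * ((π w.X)⁻¹ * r w.feat ^ 2))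
    = ind w.A * ((π w.X)⁻¹ * (ind (g w) * r w.feat ^ 2))
  ring

/-- The inverse-probability weighted regression residual is orthogonal to bounded functions of the
strata. -/
lemma integral_residual_mul_eq_zero [IsFiniteMeasure Q]
    (hπ : Overlap π η) (hg : IsGroup g e) {Y : Obs k l → ℝ} (hY : Integrable Y Q[|annotated g])
    {r : Feat k l → ℝ} (hr : (fun w => r w.feat) =ᵐ[Q[|annotated g]]
      (Q[|annotated g])[Y | MeasurableSpace.comap Obs.feat inferInstance])
    {b : Feat k l × Bool × Bool → ℝ} (hb : Measurable b) {c : ℝ} (hc : ∀ v, |b v| ≤ c) :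
    ∫ w, ind (g w) * (ind w.A * ((π w.X)⁻¹ * (Y w - r w.feat) * b w.strata)) ∂Q = 0 := by
  have hgm := hg.measurable
  -- Within the group the strata equal (features, `e`), so `b` becomes a function of the features
  -- alone and the defining property of the regression applies.
  have hum : Measurable fun x : Feat k l => (π x.1)⁻¹ * b (x, e) :=
    (hπ.measurable.comp measurable_fst).inv.mul (hb.comp (measurable_id.prodMk measurable_const))
  have hub : ∀ x : Feat k l, |(π x.1)⁻¹ * b (x, e)| ≤ η⁻¹ * c := fun x => by
    rw [abs_mul]
    exact mul_le_mul (hπ.abs_inv_le _) (hc _) (abs_nonneg _) (inv_nonneg.2 hπ.pos.le)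
  have h2 := integral_annotated_mul_regression hgm Q hY hr hum hub
  have hri : Integrable (fun w => r w.feat) Q[|annotated g] := integrable_condExp.congr hr.symm
  have i1 : ∀ {f : Obs k l → ℝ}, Integrable f Q[|annotated g] → Integrable (fun w =>
      ind (g w) * (ind w.A * ((π w.feat.1)⁻¹ * b (w.feat, e) * f w))) Q := fun {f} hf =>
    (integrable_annotated hgm Q _).2 (hf.bdd_mul (hum.comp Obs.measurable_feat).aestronglyMeasurable
      (.of_forall fun w => hub w.feat))
  rw [← sub_eq_zero.2 h2.symm, ← integral_sub (i1 hY) (i1 hri)]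
  refine integral_congr_ae (.of_forall fun w => ?_)
  by_cases hw : g w = true
  · simp only [hg.strata_eq hw]
    change ind (g w) * (ind w.A * ((π w.feat.1)⁻¹ * (Y w - r w.feat) * b (w.feat, e))) = _
    ring
  · simp [ind, hw]

end Overlap

end DiD

/-! ### The identified functional as a linear functional on the model -/

namespace DiD

variable {k l : ℕ} {π : (Fin 2 → Fin k → ℝ) → ℝ} {η : ℝ}

/-- A conditional expectation given the features factors through them everywhere, not just almost
everywhere. This gives the regression a meaning on units outside the annotated group, over which the
functional integrates it. -/
lemma exists_regression_eq (g : Obs k l → Bool) (Q : Measure (Obs k l)) :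
    ∃ r : Feat k l → ℝ, Measurable r ∧ regression g Q = fun w => r w.feat := by
  obtain ⟨r, hr, h⟩ := (stronglyMeasurable_condExp (f := Obs.M)
    (μ := Q[|annotated g]) (m := MeasurableSpace.comap Obs.feat inferInstance)
    ).exists_eq_measurable_comp
  exact ⟨r, hr.measurable, h⟩

lemma memLp_ind_mul_M {Q : Measure (Obs k l)}
    (h : ∫⁻ w, ENNReal.ofReal (ind w.A * w.M ^ 2) ∂Q < ∞) :
    MemLp (fun w => ind w.A * w.M) 2 Q := by
  rw [memLp_two_iff_integrable_sq (by fun_prop)]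
  refine ⟨by fun_prop, ?_⟩
  rw [hasFiniteIntegral_iff_ofReal (.of_forall fun w => sq_nonneg _)]
  simpa only [mul_pow, sq (ind _), ind_mul_self] using h

lemma memLp_M_cond {Q : Measure (Obs k l)} [IsFiniteMeasure Q] {g : Obs k l → Bool}
    (hg : Measurable g) (h : ∫⁻ w, ENNReal.ofReal (ind w.A * w.M ^ 2) ∂Q < ∞) :
    MemLp Obs.M 2 Q[|annotated g] :=
  (memLp_cond Q _ (memLp_ind_mul_M h)).ae_eq
    ((ae_cond_annotated hg Q).mono fun w hw => by simp [hw.2, ind_true])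

/-- The integrand of the identified functional after inverse probability weighting. -/
noncomputable def ipwContrast (π : (Fin 2 → Fin k → ℝ) → ℝ) (pG pC : ℝ) (w : Obs k l) : ℝ :=
  (π w.X)⁻¹ * (ind w.G / pG - ind w.C / pC) * (ind w.A * w.M)

lemma measurable_ipwContrast (hπ : Measurable π) (pG pC : ℝ) :
    Measurable (ipwContrast π pG pC : Obs k l → ℝ) := by
  unfold ipwContrast; fun_prop

lemma sq_ipwContrast_le (hπ : Overlap π η) (pG pC : ℝ) (w : Obs k l) :
    ipwContrast π pG pC w ^ 2 ≤ (η⁻¹ * (|pG⁻¹| + |pC⁻¹|)) ^ 2 * (ind w.A * w.M ^ 2) := by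
  have e : (ind w.A * w.M) ^ 2 = ind w.A * w.M ^ 2 := by rw [mul_pow, sq (ind _), ind_mul_self]
  rw [ipwContrast, mul_pow, e]
  refine mul_le_mul_of_nonneg_right ?_ (mul_nonneg (ind_nonneg _) (sq_nonneg _))
  rw [← sq_abs, abs_mul]
  refine pow_le_pow_left₀ (by positivity) ?_ 2
  refine mul_le_mul (hπ.abs_inv_le _) ?_ (abs_nonneg _) (inv_nonneg.2 hπ.pos.le)
  refine (abs_sub _ _).trans ?_
  rw [div_eq_mul_inv, div_eq_mul_inv, abs_mul, abs_mul, abs_of_nonneg (ind_nonneg _),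
    abs_of_nonneg (ind_nonneg _)]
  gcongr
  · exact mul_le_of_le_one_left (abs_nonneg _) (ind_le_one _)
  · exact mul_le_of_le_one_left (abs_nonneg _) (ind_le_one _)

/-- The second moment of the contrast is controlled by that of the annotated outcome change. -/
lemma lintegral_sq_ipwContrast_le (hπ : Overlap π η) (pG pC : ℝ) (Q : Measure (Obs k l)) :
    ∫⁻ w, ENNReal.ofReal (ipwContrast π pG pC w ^ 2) ∂Q
      ≤ ENNReal.ofReal ((η⁻¹ * (|pG⁻¹| + |pC⁻¹|)) ^ 2)
        * ∫⁻ w, ENNReal.ofReal (ind w.A * w.M ^ 2) ∂Q := by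
  rw [← lintegral_const_mul _ (by fun_prop)]
  refine lintegral_mono fun w => ?_
  rw [← ENNReal.ofReal_mul (sq_nonneg _)]
  exact ENNReal.ofReal_le_ofReal (sq_ipwContrast_le hπ pG pC w)

lemma memLp_ipwContrast (hπ : Overlap π η) (pG pC : ℝ) {Q : Measure (Obs k l)}
    (h : ∫⁻ w, ENNReal.ofReal (ind w.A * w.M ^ 2) ∂Q < ∞) : MemLp (ipwContrast π pG pC) 2 Q := by
  have hm := measurable_ipwContrast (l := l) hπ.measurable pG pC
  rw [memLp_two_iff_integrable_sq hm.aestronglyMeasurable]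
  refine ⟨(hm.pow_const 2).aestronglyMeasurable, ?_⟩
  rw [hasFiniteIntegral_iff_ofReal (.of_forall fun w => sq_nonneg _)]
  exact (lintegral_sq_ipwContrast_le hπ pG pC Q).trans_lt
    (ENNReal.mul_lt_top ENNReal.ofReal_lt_top h)

/-- The identified functional is linear on the model. -/
lemma identified_eq_integral (hπ : Overlap π η) {Q : Measure (Obs k l)} [IsFiniteMeasure Q]
    (hQ : Scored π Q) (h : ∫⁻ w, ENNReal.ofReal (ind w.A * w.M ^ 2) ∂Q < ∞) (pG pC : ℝ) :
    identified pG pC Q = ∫ w, ipwContrast π pG pC w ∂Q := by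
  -- The regression depends on Q, but its group mean is the mean of g A M / π, an integrand free of
  -- Q.
  have key : ∀ {g : Obs k l → Bool} {e}, IsGroup g e → ∀ p : ℝ,
      ∫ w, ind (g w) / p * regression g Q w ∂Q
        = ∫ w, p⁻¹ * (ind (g w) * (ind w.A * ((π w.X)⁻¹ * w.M))) ∂Q := by
    intro g e hg p
    obtain ⟨r, hrm, hr⟩ := exists_regression_eq g Q
    rw [integral_const_mul, ← hQ.integral_group_mul_regression hπ hg
      ((memLp_M_cond hg.measurable h).integrable one_le_two) hrm
      (Filter.EventuallyEq.of_eq hr.symm), ← integral_const_mul, hr]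
    exact integral_congr_ae (.of_forall fun w => by simp only; ring)
  have int : ∀ {g : Obs k l → Bool} {e}, IsGroup g e → ∀ p : ℝ,
      Integrable (fun w => p⁻¹ * (ind (g w) * (ind w.A * ((π w.X)⁻¹ * w.M)))) Q := by
    intro g e hg p
    refine Integrable.const_mul ((integrable_annotated hg.measurable Q _).2 ?_) _
    exact ((memLp_M_cond hg.measurable h).integrable one_le_two).bdd_mul (c := η⁻¹)
      (hπ.measurable.comp Obs.measurable_X).inv.aestronglyMeasurable
      (.of_forall fun w => hπ.abs_inv_le _)
  rw [identified, key isGroup_G, key isGroup_C, ← integral_sub (int isGroup_G _) (int isGroup_C _)]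
  refine integral_congr_ae (.of_forall fun w => ?_)
  simp only [ipwContrast]
  ring

/-! ### Complete data: missingness at random and identification -/

namespace Full

@[fun_prop]
lemma measurable_G : Measurable (G : Full k l → Bool) :=
  (Measurable.of_discrete (f := cohort)).comp (measurable_fst.comp measurable_snd)

@[fun_prop]
lemma measurable_C : Measurable (C : Full k l → Bool) :=
  (Measurable.of_discrete (f := never)).comp (measurable_fst.comp measurable_snd)

@[fun_prop]
lemma measurable_A : Measurable (A : Full k l → Bool) :=
  (Measurable.of_discrete (f := both)).comp
    (measurable_fst.comp (measurable_snd.comp measurable_snd))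

attribute [fun_prop] measurable_X measurable_U measurable_Mstar measurable_truth

@[fun_prop]
lemma measurable_obs : Measurable (obs : Full k l → Obs k l) := by
  refine Measurable.prodMk (measurable_pi_lambda _ fun t => ?_) measurable_snd
  refine Measurable.mul ?_ (measurable_truth t)
  exact (Measurable.of_discrete (f := fun a : Fin 2 → Bool => ind (a t))).comp
    (measurable_fst.comp (measurable_snd.comp measurable_snd))

/-- Among annotated units the outcome change is observed. -/
lemma ind_mul_M_obs (z : Full k l) : ind z.A * z.obs.M = ind z.A * z.Mstar := by
  by_cases h : z.A = true
  · have h' : z.2.2.1 0 = true ∧ z.2.2.1 1 = true := by simpa [A, both] using h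
    simp [Obs.M, obs, Mstar, ind, h'.1, h'.2]
  · simp [ind, h]

end Full

variable {F : Measure (Full k l)} [IsProbabilityMeasure F]

lemma Assumptions.exists_overlap (hF : Assumptions F π) : ∃ η, Overlap π η := by
  obtain ⟨η, h0, -, h⟩ := hF.overlap
  exact ⟨η, hF.measurable_score, h0, fun x => (h x).1, fun x => (h x).2⟩

/-- Under missingness at random, `π(X)` is the conditional probability of annotation given the
features, the outcome change and the groups. -/
lemma Assumptions.hasScore (hF : Assumptions F π) :
    HasScore F Full.A (fun z : Full k l => ((z.X, z.U, z.Mstar), (z.C, z.G)))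
      fun v => π v.1.1 := by
  obtain ⟨η, hπ⟩ := hF.exists_overlap
  have hm := hF.measurable_score
  have h1 : HasScore F Full.A (Full.X : Full k l → _) π :=
    (hasScore_iff_condExp Full.measurable_A Full.measurable_X hm (fun x => (hπ.pos' x).le)
      (Integrable.of_bound (hm.comp Full.measurable_X).aestronglyMeasurable 1
        (.of_forall fun w => by
          rw [Real.norm_eq_abs, abs_of_pos (hπ.pos' _)]; exact hπ.le_one _))).2 hF.score
  -- The conditioning grows from X to (X, U, M*) by the first missingness assumption, then to (X, U,
  -- M*, C, G) by the second; the score stays π(X).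
  have h2 : HasScore F Full.A (fun z : Full k l => (z.X, z.U, z.Mstar)) fun v => π v.1 :=
    hasScore_prodMk_of_condIndepFun (Z := Full.X) (V := fun z : Full k l => (z.U, z.Mstar))
      Full.measurable_A Full.measurable_X (by fun_prop) hm (fun x => (hπ.pos' x).le) hπ.le_one
      h1 hF.missing_at_random
  exact hasScore_prodMk_of_condIndepFun (Z := fun z : Full k l => (z.X, z.U, z.Mstar))
    (V := fun z : Full k l => (z.C, z.G)) (p := fun v => π v.1) Full.measurable_A
    (by fun_prop) (by fun_prop) (hm.comp measurable_fst)
    (fun x => (hπ.pos' x.1).le) (fun x => hπ.le_one x.1) h2 hF.groups_missing_at_random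

/-- The score given (X, U, M*, C, G) depends on X only, so it remains the score after M* is dropped.
-/
lemma Assumptions.scored (hF : Assumptions F π) : Scored π (F.map Full.obs) := by
  rw [Scored, hasScore_map_iff Full.measurable_obs Obs.measurable_A Obs.measurable_strata]
  have hm := hF.measurable_score
  let u : ((Fin 2 → Fin k → ℝ) × (Fin 2 → Fin l → ℝ) × ℝ) × Bool × Bool
      → Feat k l × Bool × Bool := fun v => ((v.1.1, v.1.2.1), (v.2.2, v.2.1))
  have hu : Measurable u := by fun_prop
  exact HasScore.comp (u := u) (p := fun v => π v.1.1) hF.hasScore (by fun_prop) hu (by fun_prop)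

lemma Assumptions.lintegral_lt_top (hF : Assumptions F π) :
    ∫⁻ w, ENNReal.ofReal (ind w.A * w.M ^ 2) ∂(F.map Full.obs) < ∞ := by
  rw [lintegral_map (by fun_prop) Full.measurable_obs]
  refine lt_of_le_of_lt (lintegral_mono fun z => ?_)
    ((hasFiniteIntegral_iff_ofReal (.of_forall fun z => sq_nonneg _)).1
      hF.memLp_Mstar.integrable_sq.2)
  refine ENNReal.ofReal_le_ofReal ?_
  have h := Full.ind_mul_M_obs z
  change ind z.A * z.obs.M ^ 2 ≤ _
  rw [show ind z.A * z.obs.M ^ 2 = (ind z.A * z.obs.M) * z.obs.M by ring]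
  have : ind z.A * z.obs.M * z.obs.M = ind z.A * z.Mstar ^ 2 := by
    calc _ = (ind z.A * z.obs.M) * (ind z.A * z.obs.M) := by
          nth_rewrite 1 [← ind_mul_self]; ring
      _ = ind z.A * ind z.A * z.Mstar ^ 2 := by rw [h]; ring
      _ = _ := by rw [ind_mul_self]
  rw [this]
  exact mul_le_of_le_one_left (sq_nonneg _) (ind_le_one _)

lemma Assumptions.mem_model (hF : Assumptions F π) : F.map Full.obs ∈ model (l := l) π := by
  obtain ⟨η, hπ⟩ := hF.exists_overlap
  have := Measure.isProbabilityMeasure_map (μ := F) Full.measurable_obs.aemeasurable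
  refine ⟨this, ?_, ?_, hF.lintegral_lt_top, (scored_iff hπ _).1 hF.scored⟩
  · exact (ae_map_iff Full.measurable_obs.aemeasurable
      ((Measurable.of_discrete (f := fun d : Fin 2 → Bool => d 0)).comp
        (measurable_fst.comp measurable_snd) (measurableSet_singleton false))).2 hF.irreversible
  · have h : ∀ z : Full k l, ∀ t, z.obs.2.2.1 t = false → z.obs.1 t = 0 := by
      intro z t ht
      change z.2.2.1 t = false at ht
      simp [Full.obs, ht, ind]
    have hmeas : MeasurableSet {w : Obs k l | ∀ t, w.2.2.1 t = false → w.1 t = 0} := by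
      simp only [Set.ofPred_forall]
      refine MeasurableSet.iInter fun t => ?_
      simp only [imp_iff_not_or, Set.ofPred_or]
      refine (MeasurableSet.compl ?_).union ?_
      · exact ((Measurable.of_discrete (f := fun a : Fin 2 → Bool => a t)).comp
          (measurable_fst.comp (measurable_snd.comp measurable_snd))) (measurableSet_singleton false)
      · exact ((measurable_pi_apply t).comp measurable_fst) (measurableSet_singleton 0)
    exact (ae_map_iff Full.measurable_obs.aemeasurable hmeas).2 (.of_forall h)

lemma integral_ind_div_mul {Ω : Type*} [MeasurableSpace Ω] {μ : Measure Ω} [IsFiniteMeasure μ]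
    {g : Ω → Bool} (hg : Measurable g) (h0 : μ {ω | g ω} ≠ 0) (f : Ω → ℝ) :
    ∫ ω, ind (g ω) / μ.real {ω | g ω} * f ω ∂μ = ∫ ω, f ω ∂μ[|{ω | g ω}] := by
  have h1 : ∀ ω, ind (g ω) / μ.real {ω | g ω} * f ω
      = (μ.real {ω | g ω})⁻¹ * (ind (g ω) * f ω) := fun ω => by ring
  have h2 : μ.real {ω | g ω} ≠ 0 := ENNReal.toReal_ne_zero.2 ⟨h0, measure_ne_top _ _⟩
  simp_rw [h1]
  rw [integral_const_mul, integral_ind_mul hg, setIntegral_eq_mul_integral_cond, ← mul_assoc,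
    inv_mul_cancel₀ h2, one_mul]

/-- The identified functional equals the average treatment effect on the treated. -/
lemma Assumptions.identified_eq_att (hF : Assumptions F π) :
    identified ((F.map Full.obs).real {w | w.G}) ((F.map Full.obs).real {w | w.C})
      (F.map Full.obs) = att F := by
  obtain ⟨η, hπ⟩ := hF.exists_overlap
  have hm := hF.measurable_score
  have hpG : (F.map Full.obs).real {w | w.G} = F.real {z | z.G} := by
    rw [Measure.real, Measure.map_apply Full.measurable_obs
      (measurableSet_eq_true Obs.measurable_G)]; rfl
  have hpC : (F.map Full.obs).real {w | w.C} = F.real {z | z.C} := by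
    rw [Measure.real, Measure.map_apply Full.measurable_obs
      (measurableSet_eq_true Obs.measurable_C)]; rfl
  have := Measure.isProbabilityMeasure_map (μ := F) Full.measurable_obs.aemeasurable
  rw [identified_eq_integral hπ hF.scored hF.lintegral_lt_top, hpG, hpC,
    integral_map Full.measurable_obs.aemeasurable
      (measurable_ipwContrast hm _ _).aestronglyMeasurable]
  set pG := F.real {z | z.G} with hpG
  set pC := F.real {z | z.C} with hpC
  let f : ((Fin 2 → Fin k → ℝ) × (Fin 2 → Fin l → ℝ) × ℝ) × Bool × Bool → ℝ :=
    fun v => (π v.1.1)⁻¹ * (ind v.2.2 / pG - ind v.2.1 / pC) * v.1.2.2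
  have hf : Measurable f := by fun_prop
  have h1 := hF.hasScore.integral_eq Full.measurable_A (by fun_prop) (by fun_prop)
    (fun v => (hπ.pos' v.1.1).le) hf
  -- M may be replaced by M* where A = 1. Since π(X) is the score even given M* and the groups, A/π
  -- then integrates as 1.
  have h2 : ∫ z, ipwContrast π pG pC (Full.obs z) ∂F
      = ∫ z, (ind z.G / pG * z.Mstar - ind z.C / pC * z.Mstar) ∂F := by
    refine Eq.trans ?_ (h1.trans ?_)
    · refine integral_congr_ae (.of_forall fun z => ?_)
      have h := Full.ind_mul_M_obs z
      change (π z.X)⁻¹ * (ind z.G / pG - ind z.C / pC) * (ind z.A * z.obs.M)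
        = ind z.A * ((π z.X)⁻¹ * (ind z.G / pG - ind z.C / pC) * z.Mstar)
      rw [h]; ring
    · refine integral_congr_ae (.of_forall fun z => ?_)
      change π z.X * ((π z.X)⁻¹ * (ind z.G / pG - ind z.C / pC) * z.Mstar) = _
      have := (hπ.pos' z.X).ne'
      field_simp
  have int : ∀ {g : Full k l → Bool}, Measurable g → ∀ p : ℝ,
      Integrable (fun z => ind (g z) / p * z.Mstar) F := fun {g} hg p =>
    (hF.memLp_Mstar.integrable one_le_two).bdd_mul (c := |p⁻¹|) (by fun_prop)
      (.of_forall fun z => by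
        rw [Real.norm_eq_abs, div_eq_mul_inv, abs_mul, abs_of_nonneg (ind_nonneg _)]
        exact mul_le_of_le_one_left (abs_nonneg _) (ind_le_one _))
  rw [h2, integral_sub (int Full.measurable_G pG) (int Full.measurable_C pC),
    integral_ind_div_mul Full.measurable_G hF.pos_cohort.ne',
    integral_ind_div_mul Full.measurable_C hF.pos_never.ne']
  have hG : ∀ᵐ z ∂F[|{z | z.G}], z.Mstar = z.Y true 1 - z.Y true 0 := by
    rw [ProbabilityTheory.cond]
    refine Measure.ae_smul_measure ((ae_restrict_mem
      (measurableSet_eq_true Full.measurable_G)).mono fun z hz => ?_) _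
    change z.G = true at hz
    simp [Full.Mstar, Full.truth, hz, ind]
  have hC : ∀ᵐ z ∂F[|{z | z.C}], z.Mstar = z.Y false 1 - z.Y false 0 := by
    rw [ProbabilityTheory.cond]
    refine Measure.ae_smul_measure ((ae_restrict_mem
      (measurableSet_eq_true Full.measurable_C)).mono fun z hz => ?_) _
    have hz' : z.G = false := by
      have h : ∀ d, never d = true → cohort d = false := by decide
      exact h _ hz
    simp [Full.Mstar, Full.truth, hz', ind]
  have iG := hF.integrable_cohort
  -- Parallel trends turns the change of the never treated into the untreated change of the cohort;
  -- no anticipation cancels the period-1 means.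
  rw [integral_congr_ae hG, integral_congr_ae hC, ← hF.parallel_trends, att,
    integral_sub (iG true 1) (iG true 0), integral_sub (iG false 1) (iG false 0),
    integral_sub (iG true 1) (iG false 1), hF.no_anticipation]
  ring

end DiD

/-! ### Orthogonality relations satisfied by the scores of the model -/

namespace DiD

variable {k l : ℕ} {π : (Fin 2 → Fin k → ℝ) → ℝ} {η : ℝ} {P : Measure (Obs k l)}

section Orthogonality

open Semiparametric

lemma abs_ind_sub_score_le (hπ : Overlap π η) (w : Obs k l) : |ind w.A - π w.X| ≤ 1 := by
  rw [abs_le]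
  have h1 := ind_nonneg w.A
  have h2 := ind_le_one w.A
  have h3 := hπ.pos' w.X
  have h4 := hπ.le_one w.X
  constructor <;> linarith

/-- The annotation residual is orthogonal to functions of the strata. -/
lemma Scored.integral_residual_eq_zero {Q : Measure (Obs k l)} [IsFiniteMeasure Q]
    (hQ : Scored π Q) (hπ : Overlap π η)
    {b : Feat k l × Bool × Bool → ℝ} (hb : Measurable b)
    (hbi : Integrable (fun w : Obs k l => b w.strata) Q) :
    ∫ w, (ind w.A - π w.X) * b w.strata ∂Q = 0 := by
  have hm := hπ.measurable
  have i1 : Integrable (fun w => ind w.A * b w.strata) Q :=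
    hbi.bdd_mul (c := 1) (Measurable.aestronglyMeasurable (by fun_prop)) (.of_forall fun w => by
      rw [Real.norm_eq_abs, abs_of_nonneg (ind_nonneg _)]; exact ind_le_one _)
  have i2 : Integrable (fun w => π w.X * b w.strata) Q :=
    hbi.bdd_mul (c := 1) (Measurable.aestronglyMeasurable (by fun_prop)) (.of_forall fun w => by
      rw [Real.norm_eq_abs, abs_of_pos (hπ.pos' _)]; exact hπ.le_one _)
  simp_rw [sub_mul]
  rw [integral_sub i1 i2, hQ.integral_ind_mul hπ hb, sub_self]

variable {Q : ℝ → Measure (Obs k l)} {h : Obs k l → ℝ}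

/-- The total mass is constantly 1 along the submodel, and its derivative is the mean of the score.
-/
lemma integral_score_eq_zero [IsProbabilityMeasure P] (hreg : Q ∈ regularPaths π) (hQ : IsQMDPath P Q h) :
    ∫ w, h w ∂P = 0 := by
  have hprob : ∀ᶠ t in 𝓝[>] (0 : ℝ), IsProbabilityMeasure (Q t) := hreg.1.mono fun t ht => ht.1
  have h1 := hQ.tendsto_diffQuotient hprob (f := fun _ => 1) measurable_const (memLp_const 1) 1
    (hprob.mono fun t ht => by simp)
  have h2 : Tendsto (fun t : ℝ => (∫ _, (1 : ℝ) ∂(Q t) - ∫ _, (1 : ℝ) ∂P) / t) (𝓝[>] 0) (𝓝 0) :=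
    tendsto_const_nhds.congr' (hprob.mono fun t ht => by simp)
  simpa using tendsto_nhds_unique h1 h2

/-- Scores of the model are orthogonal to the annotation residual times functions of the strata. -/
lemma integral_residual_mul_score_eq_zero [IsProbabilityMeasure P] (hπ : Overlap π η) (hP : Scored π P)
    (hreg : Q ∈ regularPaths π) (hQ : IsQMDPath P Q h)
    {b : Feat k l × Bool × Bool → ℝ} (hb : Measurable b)
    (hbL : MemLp (fun w : Obs k l => b w.strata) 2 P) :
    ∫ w, ((ind w.A - π w.X) * b w.strata) * h w ∂P = 0 := by
  have hm := hπ.measurable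
  have hprob : ∀ᶠ t in 𝓝[>] (0 : ℝ), IsProbabilityMeasure (Q t) := hreg.1.mono fun t ht => ht.1
  -- For bounded b the functional E_Q[(A - π) b(S)] is zero at every law of the model, so its
  -- derivative along the path is zero. Boundedness supplies the uniform second moment.
  have bounded : ∀ b : Feat k l × Bool × Bool → ℝ, Measurable b → ∀ c : ℝ, (∀ v, |b v| ≤ c) →
      ∫ w, ((ind w.A - π w.X) * b w.strata) * h w ∂P = 0 := by
    intro b hb c hc
    have hc0 : 0 ≤ c := (abs_nonneg _).trans (hc (0, true, true))
    have hfm : Measurable fun w : Obs k l => (ind w.A - π w.X) * b w.strata := by fun_prop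
    have hfc : ∀ w : Obs k l, |(ind w.A - π w.X) * b w.strata| ≤ c := fun w => by
      rw [abs_mul]
      exact (mul_le_mul (abs_ind_sub_score_le hπ w) (hc _) (abs_nonneg _) zero_le_one).trans_eq
        (one_mul c)
    have hbi : ∀ R : Measure (Obs k l), IsFiniteMeasure R →
        Integrable (fun w : Obs k l => b w.strata) R := fun R _ =>
      Integrable.of_bound (Measurable.aestronglyMeasurable (by fun_prop)) c (.of_forall fun w => hc _)
    have h1 := hQ.tendsto_diffQuotient hprob hfm
      (MemLp.of_bound hfm.aestronglyMeasurable c (.of_forall hfc)) (c ^ 2).toNNReal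
      (hprob.mono fun t ht => by
        refine (lintegral_mono fun w => ENNReal.ofReal_le_ofReal
          (q := c ^ 2) ?_).trans ?_
        · rw [← sq_abs]; exact pow_le_pow_left₀ (abs_nonneg _) (hfc w) 2
        · simp [ENNReal.ofReal])
    have h2 : Tendsto (fun t : ℝ => (∫ w, (ind w.A - π w.X) * b w.strata ∂(Q t)
        - ∫ w, (ind w.A - π w.X) * b w.strata ∂P) / t) (𝓝[>] 0) (𝓝 0) := by
      refine tendsto_const_nhds.congr' (hreg.1.mono fun t ht => ?_)
      have := ht.1
      simp only [((scored_iff hπ _).2 ht.2.2.2.2).integral_residual_eq_zero hπ hb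
        (hbi _ inferInstance), hP.integral_residual_eq_zero hπ hb (hbi _ inferInstance), sub_self,
        zero_div]
    exact tendsto_nhds_unique h1 h2
  -- Truncation removes the boundedness: the integrands are dominated by |b h|, integrable as a
  -- product of two L² functions.
  let b' : ℕ → Feat k l × Bool × Bool → ℝ := fun n v => {v | |b v| ≤ n}.indicator b v
  have hset : ∀ n : ℕ, MeasurableSet {v | |b v| ≤ n} := fun n =>
    measurableSet_le (by fun_prop) measurable_const
  have hb' : ∀ n, Measurable (b' n) := fun n => hb.indicator (hset n)
  have hb'c : ∀ n v, |b' n v| ≤ n := fun n v => by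
    by_cases hv : |b v| ≤ n <;> simp [b', Set.indicator, hv]
  have hb'b : ∀ n v, |b' n v| ≤ |b v| := fun n v => by
    by_cases hv : |b v| ≤ n <;> simp [b', Set.indicator, hv]
  have hh := hQ.2.1
  have lim := tendsto_integral_of_dominated_convergence (μ := P)
    (F := fun n w => ((ind w.A - π w.X) * b' n w.strata) * h w)
    (f := fun w => ((ind w.A - π w.X) * b w.strata) * h w) (fun w => |b w.strata * h w|)
    (fun n => by
      have := hb' n
      exact AEStronglyMeasurable.mul (by fun_prop) hh.1)
    (hbL.integrable_mul hh).abs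
    (fun n => .of_forall fun w => by
      rw [Real.norm_eq_abs, abs_mul, abs_mul, abs_mul]
      refine mul_le_mul_of_nonneg_right ?_ (abs_nonneg _)
      exact (mul_le_mul (abs_ind_sub_score_le hπ w) (hb'b _ _) (abs_nonneg _)
        zero_le_one).trans_eq (one_mul _))
    (.of_forall fun w => by
      refine tendsto_const_nhds.congr' ?_
      obtain ⟨N, hN⟩ := exists_nat_ge |b w.strata|
      filter_upwards [eventually_ge_atTop N] with n hn
      have : |b w.strata| ≤ n := hN.trans (by exact_mod_cast hn)
      simp [b', Set.indicator, this])
  refine tendsto_nhds_unique lim ?_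
  simp only [bounded _ (hb' _) _ (hb'c _)]
  exact tendsto_const_nhds

end Orthogonality

/-! ### Linear submodels that stay in the model -/

section LinearPath

open Semiparametric

lemma setIntegral_linearPath {s : Obs k l → ℝ} (hs : Measurable s) {t : ℝ}
    (ht : ∀ᵐ w ∂P, -1 ≤ t * s w) {S : Set (Obs k l)} (hS : MeasurableSet S) (f : Obs k l → ℝ) :
    ∫ w in S, f w ∂(linearPath P s t) = ∫ w in S, (1 + t * s w) * f w ∂P := by
  rw [← integral_indicator hS, integral_linearPath hs ht, ← integral_indicator hS]
  refine integral_congr_ae (.of_forall fun w => ?_)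
  by_cases hw : w ∈ S <;> simp [hw]

/-- A bounded score orthogonal to the annotation residual is the score of a regular submodel. -/
lemma linearPath_mem_regularPaths [IsProbabilityMeasure P] (hπ : Overlap π η) (hP : P ∈ model π) {s : Obs k l → ℝ}
    (hs : Measurable s) {c : ℝ} (hc : ∀ᵐ w ∂P, |s w| ≤ c) (h0 : ∫ w, s w ∂P = 0)
    (horth : ∀ B : Set (Feat k l × Bool × Bool), MeasurableSet B →
      ∫ w in Obs.strata ⁻¹' B, (ind w.A - π w.X) * s w ∂P = 0) :
    linearPath P s ∈ regularPaths π := by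
  have hm := hπ.measurable
  have hsi : Integrable s P := (MemLp.of_bound (p := 1) hs.aestronglyMeasurable c hc).integrable
    le_rfl
  -- For small t the density 1 + t s is at most 1 + t c ≤ 2.
  have hbound : ∀ᶠ t in 𝓝[>] (0 : ℝ), ∫⁻ w, ENNReal.ofReal (ind w.A * w.M ^ 2) ∂(linearPath P s t)
      ≤ 2 * ∫⁻ w, ENNReal.ofReal (ind w.A * w.M ^ 2) ∂P := by
    filter_upwards [eventually_one_add_mul_nonneg hc] with t ⟨ht0, ht1, ht⟩
    rw [linearPath, lintegral_withDensity_eq_lintegral_mul _ (by fun_prop) (by fun_prop),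
      ← lintegral_const_mul _ (by fun_prop)]
    refine lintegral_mono_ae (ht.mono fun w hw => ?_)
    simp only [Pi.mul_apply]
    gcongr
    have : 1 + t * s w ≤ 2 := by linarith [(abs_le.1 hw).2]
    exact (ENNReal.ofReal_le_ofReal this).trans_eq (by simp)
  have hfin : 2 * ∫⁻ w, ENNReal.ofReal (ind w.A * w.M ^ 2) ∂P < ∞ :=
    ENNReal.mul_lt_top (by simp) hP.2.2.2.1
  refine ⟨?_, (2 * ∫⁻ w, ENNReal.ofReal (ind w.A * w.M ^ 2) ∂P).toNNReal, ?_⟩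
  · filter_upwards [eventually_one_add_mul_nonneg hc, hbound] with t ⟨ht0, ht1, ht⟩ hb
    have hlow : ∀ᵐ w ∂P, -1 ≤ t * s w := ht.mono fun w hw => by linarith [(abs_le.1 hw).1]
    have hprob := isProbabilityMeasure_linearPath hsi h0 hlow
    have hac : linearPath P s t ≪ P := withDensity_absolutelyContinuous _ _
    refine ⟨hprob, hac.ae_le hP.2.1, hac.ae_le hP.2.2.1, hb.trans_lt hfin,
      (scored_iff hπ _).1 ?_⟩
    refine (hasScore_iff Obs.measurable_A Obs.measurable_strata hπ.measurable_strata
      (fun v => (hπ.pos' v.1.1).le) (hπ.integrable_score _)).2 fun B hB => ?_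
    have hS := Obs.measurable_strata hB
    rw [setIntegral_linearPath hs hlow hS, setIntegral_linearPath hs hlow hS]
    have e1 := (hasScore_iff Obs.measurable_A Obs.measurable_strata hπ.measurable_strata
      (fun v => (hπ.pos' v.1.1).le) (hπ.integrable_score P)).1 ((scored_iff hπ _).2 hP.2.2.2.2) B hB
    have e2 := horth B hB
    have iA := integrable_ind_comp (μ := P) (Obs.measurable_A (k := k) (l := l))
    have iπ := hπ.integrable_score P
    have iAs : Integrable (fun w => ind w.A * s w) P :=
      hsi.bdd_mul (c := 1) (Measurable.aestronglyMeasurable (by fun_prop)) (.of_forall fun w => by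
        rw [Real.norm_eq_abs, abs_of_nonneg (ind_nonneg _)]; exact ind_le_one _)
    have iπs : Integrable (fun w => π w.X * s w) P :=
      hsi.bdd_mul (c := 1) (Measurable.aestronglyMeasurable (by fun_prop)) (.of_forall fun w => by
        rw [Real.norm_eq_abs, abs_of_pos (hπ.pos' _)]; exact hπ.le_one _)
    simp_rw [sub_mul] at e2
    rw [integral_sub iAs.integrableOn iπs.integrableOn] at e2
    change ∫ w in Obs.strata ⁻¹' B, (1 + t * s w) * π w.X ∂P = _
    change ∫ w in Obs.strata ⁻¹' B, π w.X ∂P = _ at e1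
    -- The score condition over `B` is affine in t: its constant term is the condition under P and
    -- its coefficient of t is the assumed orthogonality, so it holds exactly along the path.
    have f1 : ∀ a b : ℝ, (1 + t * a) * b = b + t * (b * a) := fun a b => by ring
    simp_rw [f1]
    rw [integral_add iπ.integrableOn (iπs.const_mul t).integrableOn,
      integral_add iA.integrableOn (iAs.const_mul t).integrableOn, integral_const_mul,
      integral_const_mul, e1, sub_eq_zero.1 e2]
  · rwa [ENNReal.coe_toNNReal hfin.ne]

end LinearPath

end DiD

/-! ### The influence function: moments and conditional means -/

namespace DiD

variable {k l : ℕ} {π : (Fin 2 → Fin k → ℝ) → ℝ} {η : ℝ} {P : Measure (Obs k l)}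
  {g : Obs k l → Bool} {e : Bool × Bool} {mu : Feat k l → ℝ}

lemma memLp_bdd_mul {Ω : Type*} [MeasurableSpace Ω] {μ : Measure Ω} {u f : Ω → ℝ} {c : ℝ}
    {p : ℝ≥0∞} (hf : MemLp f p μ) (hu : Measurable u) (hc : ∀ w, |u w| ≤ c) :
    MemLp (fun w => u w * f w) p μ :=
  hf.of_le_mul (c := c) (hu.aestronglyMeasurable.mul hf.1) (.of_forall fun w => by
    rw [norm_mul]; exact mul_le_mul_of_nonneg_right (hc w) (norm_nonneg _))

/-- The weighted regression residual of a group. -/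
noncomputable def residual (π : (Fin 2 → Fin k → ℝ) → ℝ) (g : Obs k l → Bool)
    (mu : Feat k l → ℝ) (w : Obs k l) : ℝ :=
  ind (g w) * (ind w.A * ((π w.X)⁻¹ * (w.M - mu w.feat)))

lemma aipw_eq (p : ℝ) (w : Obs k l) :
    aipw π g p mu w = p⁻¹ * (ind (g w) * mu w.feat) + p⁻¹ * residual π g mu w := by
  unfold aipw residual; ring

lemma measurable_aipw (hπ : Measurable π) (hg : Measurable g) (hmu : Measurable mu) (p : ℝ) :
    Measurable (aipw π g p mu) := by
  unfold aipw; fun_prop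

lemma memLp_group_mul [IsFiniteMeasure P] (hπ : Overlap π η) (hP : P ∈ model π)
    (hg : IsGroup g e) (hmu : IsRegression g P mu) :
    MemLp (fun w => ind (g w) * mu w.feat) 2 P :=
  ((scored_iff hπ _).2 hP.2.2.2.2).memLp_group_mul_regression hπ hg
    (memLp_M_cond hg.measurable hP.2.2.2.1) hmu.1 hmu.2

lemma memLp_residual [IsFiniteMeasure P] (hπ : Overlap π η) (hP : P ∈ model π)
    (hg : IsGroup g e) (hmu : IsRegression g P mu) : MemLp (residual π g mu) 2 P := by
  have hgm := hg.measurable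
  have hm := hπ.measurable
  have h1 := memLp_bdd_mul (u := fun w => (π w.X)⁻¹ * ind (g w)) (c := η⁻¹)
    (memLp_ind_mul_M hP.2.2.2.1) (by fun_prop) (fun w => by
      rw [abs_mul, abs_of_nonneg (ind_nonneg _)]
      exact (mul_le_of_le_one_right (abs_nonneg _) (ind_le_one _)).trans (hπ.abs_inv_le _))
  have h2 := memLp_bdd_mul (u := fun w => (π w.X)⁻¹ * ind w.A) (c := η⁻¹)
    (memLp_group_mul hπ hP hg hmu) (by fun_prop) (fun w => by
      rw [abs_mul, abs_of_nonneg (ind_nonneg _)]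
      exact (mul_le_of_le_one_right (abs_nonneg _) (ind_le_one _)).trans (hπ.abs_inv_le _))
  refine (h1.sub h2).ae_eq (.of_forall fun w => ?_)
  simp only [Pi.sub_apply, residual]
  ring

lemma memLp_aipw [IsFiniteMeasure P] (hπ : Overlap π η) (hP : P ∈ model π)
    (hg : IsGroup g e) (hmu : IsRegression g P mu) (p : ℝ) : MemLp (aipw π g p mu) 2 P :=
  (((memLp_group_mul hπ hP hg hmu).const_mul p⁻¹).add
    ((memLp_residual hπ hP hg hmu).const_mul p⁻¹)).ae_eq (.of_forall fun w => (aipw_eq p w).symm)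

lemma integral_residual_mul [IsFiniteMeasure P] (hπ : Overlap π η) (hP : P ∈ model π)
    (hg : IsGroup g e) (hmu : IsRegression g P mu) {b : Feat k l × Bool × Bool → ℝ}
    (hb : Measurable b) {c : ℝ} (hc : ∀ v, |b v| ≤ c) :
    ∫ w, residual π g mu w * b w.strata ∂P = 0 := by
  rw [← integral_residual_mul_eq_zero hπ hg
    ((memLp_M_cond hg.measurable hP.2.2.2.1).integrable one_le_two) hmu.2 hb hc]
  refine integral_congr_ae (.of_forall fun w => ?_)
  simp only [residual]
  ring

lemma integral_residual [IsFiniteMeasure P] (hπ : Overlap π η) (hP : P ∈ model π)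
    (hg : IsGroup g e) (hmu : IsRegression g P mu) : ∫ w, residual π g mu w ∂P = 0 := by
  simpa using integral_residual_mul hπ hP hg hmu (b := fun _ => 1) measurable_const (c := 1)
    (by simp)

/-- The weighted residual has mean zero, so only the group mean of the regression survives. -/
lemma integral_aipw [IsFiniteMeasure P] (hπ : Overlap π η) (hP : P ∈ model π)
    (hg : IsGroup g e) (hmu : IsRegression g P mu) (hpos : P {w | g w} ≠ 0) :
    ∫ w, aipw π g (P.real {w | g w}) mu w ∂P = ∫ w, mu w.feat ∂P[|{w | g w}] := by
  have i1 := (memLp_group_mul hπ hP hg hmu).integrable one_le_two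
  have i2 := (memLp_residual hπ hP hg hmu).integrable one_le_two
  simp_rw [aipw_eq]
  rw [integral_add (i1.const_mul _) (i2.const_mul _), integral_const_mul, integral_const_mul,
    integral_residual hπ hP hg hmu, mul_zero, add_zero, ← integral_ind_div_mul hg.measurable hpos,
    ← integral_const_mul]
  exact integral_congr_ae (.of_forall fun w => by simp only; ring)

lemma integral_influence [IsProbabilityMeasure P] (hπ : Overlap π η) (hP : P ∈ model π)
    (hg : IsGroup g e) (hmu : IsRegression g P mu) (hpos : P {w | g w} ≠ 0) :
    ∫ w, influence P π g mu w ∂P = 0 := by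
  simp only [influence]
  rw [integral_sub ((memLp_aipw hπ hP hg hmu _).integrable one_le_two) (integrable_const _),
    integral_aipw hπ hP hg hmu hpos]
  simp

lemma memLp_influence [IsProbabilityMeasure P] (hπ : Overlap π η) (hP : P ∈ model π)
    (hg : IsGroup g e) (hmu : IsRegression g P mu) : MemLp (influence P π g mu) 2 P :=
  (memLp_aipw hπ hP hg hmu _).sub (memLp_const _)

/-- The influence function of the difference of the two groups. -/
noncomputable def eif (P : Measure (Obs k l)) (π : (Fin 2 → Fin k → ℝ) → ℝ)
    (muG muC : Feat k l → ℝ) (w : Obs k l) : ℝ :=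
  influence P π Obs.G muG w - influence P π Obs.C muC w

variable {muG muC : Feat k l → ℝ}

lemma memLp_eif [IsProbabilityMeasure P] (hπ : Overlap π η) (hP : P ∈ model π)
    (hG : IsRegression Obs.G P muG) (hC : IsRegression Obs.C P muC) :
    MemLp (eif P π muG muC) 2 P :=
  (memLp_influence hπ hP isGroup_G hG).sub (memLp_influence hπ hP isGroup_C hC)

lemma integral_eif [IsProbabilityMeasure P] (hπ : Overlap π η) (hP : P ∈ model π)
    (hG : IsRegression Obs.G P muG) (hC : IsRegression Obs.C P muC)
    (hpG : P {w | w.G} ≠ 0) (hpC : P {w | w.C} ≠ 0) : ∫ w, eif P π muG muC w ∂P = 0 := by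
  simp only [eif]
  rw [integral_sub ((memLp_influence hπ hP isGroup_G hG).integrable one_le_two)
    ((memLp_influence hπ hP isGroup_C hC).integrable one_le_two),
    integral_influence hπ hP isGroup_G hG hpG, integral_influence hπ hP isGroup_C hC hpC, sub_self]

/-- The constant subtracted in the influence function is the value of the functional. -/
lemma identified_eq_sub [IsProbabilityMeasure P] (hπ : Overlap π η) (hP : P ∈ model π)
    (hG : IsRegression Obs.G P muG) (hC : IsRegression Obs.C P muC)
    (hpG : P {w | w.G} ≠ 0) (hpC : P {w | w.C} ≠ 0) :
    identified (P.real {w | w.G}) (P.real {w | w.C}) P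
      = ∫ w, muG w.feat ∂P[|{w | w.G}] - ∫ w, muC w.feat ∂P[|{w | w.C}] := by
  have hS := (scored_iff hπ _).2 hP.2.2.2.2
  have key : ∀ {g : Obs k l → Bool} {e} {mu : Feat k l → ℝ}, IsGroup g e → IsRegression g P mu →
      P {w | g w} ≠ 0 → ∫ w, ind (g w) / P.real {w | g w} * regression g P w ∂P
        = ∫ w, mu w.feat ∂P[|{w | g w}] := by
    intro g e mu hg hmu hpos
    obtain ⟨r, hrm, hr⟩ := exists_regression_eq g P
    have hM := (memLp_M_cond hg.measurable hP.2.2.2.1).integrable one_le_two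
    -- Two versions of the regression agree only almost everywhere among annotated units, but both
    -- have the inverse-weighted mean of M as their mean over the group.
    have h1 := hS.integral_group_mul_regression hπ hg hM hmu.1 hmu.2
    have h2 := hS.integral_group_mul_regression hπ hg hM hrm (Filter.EventuallyEq.of_eq hr.symm)
    rw [← integral_ind_div_mul hg.measurable hpos, hr]
    have h3 : ∀ f : Feat k l → ℝ, ∫ w, ind (g w) / P.real {w | g w} * f w.feat ∂P
        = (P.real {w | g w})⁻¹ * ∫ w, ind (g w) * f w.feat ∂P := fun f => by
      rw [← integral_const_mul]
      exact integral_congr_ae (.of_forall fun w => by simp only; ring)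
    rw [h3, h3, h1, h2]
  rw [identified, key isGroup_G hG hpG, key isGroup_C hC hpC]

/-- The part of the influence function that depends on the strata only. -/
noncomputable def strataPart (pG pC c : ℝ) (muG muC : Feat k l → ℝ)
    (v : Feat k l × Bool × Bool) : ℝ :=
  pG⁻¹ * (sel (true, false) v * muG v.1) - pC⁻¹ * (sel (false, true) v * muC v.1) - c

/-- Splits the influence function into residuals, which have mean zero given strata and annotation,
and a function of the strata. No component in the direction of A given the strata is left. -/
lemma eif_eq (w : Obs k l) : eif P π muG muC w =
    (P.real {w | w.G})⁻¹ * residual π Obs.G muG w - (P.real {w | w.C})⁻¹ * residual π Obs.C muC w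
    + strataPart (P.real {w | w.G}) (P.real {w | w.C})
        (∫ w, muG w.feat ∂P[|{w | w.G}] - ∫ w, muC w.feat ∂P[|{w | w.C}]) muG muC w.strata := by
  simp only [eif, influence, aipw_eq, strataPart, isGroup_G.sel_strata, isGroup_C.sel_strata]
  have h : w.strata.1 = w.feat := rfl
  rw [h]
  ring

/-- The information in the strata and the annotation indicator. -/
abbrev annotatedStrata (k l : ℕ) : MeasurableSpace (Obs k l) :=
  MeasurableSpace.comap (fun w : Obs k l => (w.strata, w.A)) inferInstance

/-- The information in the strata. -/
abbrev strataInfo (k l : ℕ) : MeasurableSpace (Obs k l) :=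
  MeasurableSpace.comap (Obs.strata : Obs k l → _) inferInstance

lemma annotatedStrata_le : annotatedStrata k l ≤ (inferInstance : MeasurableSpace (Obs k l)) :=
  (Obs.measurable_strata.prodMk Obs.measurable_A).comap_le

lemma strataInfo_le : strataInfo k l ≤ (inferInstance : MeasurableSpace (Obs k l)) :=
  Obs.measurable_strata.comap_le

lemma strataInfo_le_annotatedStrata : strataInfo k l ≤ annotatedStrata k l := by
  rintro _ ⟨B, hB, rfl⟩
  exact ⟨Prod.fst ⁻¹' B, measurable_fst hB, rfl⟩

/-- The regression residual has conditional mean zero given the strata and the annotation. -/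
lemma condExp_residual [IsProbabilityMeasure P] (hπ : Overlap π η) (hP : P ∈ model π)
    (hg : IsGroup g e) (hmu : IsRegression g P mu) :
    P[residual π g mu | annotatedStrata k l] =ᵐ[P] 0 := by
  refine (ae_eq_condExp_of_forall_setIntegral_eq annotatedStrata_le
    ((memLp_residual hπ hP hg hmu).integrable one_le_two)
    (fun s _ _ => (integrable_zero _ _ _).integrableOn) ?_
    aestronglyMeasurable_zero).symm
  rintro _ ⟨B, hB, rfl⟩ -
  -- The residual vanishes on unannotated units, so only the slice A = 1 of the event `B` matters,
  -- and its indicator is a bounded function of the strata.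
  have hm : Measurable fun v : Feat k l × Bool × Bool => B.indicator (fun _ => (1 : ℝ)) (v, true) :=
    (measurable_const.indicator hB).comp (measurable_id.prodMk measurable_const)
  have h := integral_residual_mul hπ hP hg hmu hm (c := 1) fun v => by
    by_cases hv : (v, true) ∈ B <;> simp [hv]
  rw [← integral_indicator (f := residual π g mu) ((Obs.measurable_strata.prodMk Obs.measurable_A) hB)]
  simp only [Pi.zero_apply, integral_zero]
  rw [← h]
  refine integral_congr_ae (.of_forall fun w => ?_)
  by_cases hA : w.A = true
  · by_cases hw : (w.strata, true) ∈ B <;> simp [Set.indicator, hA, hw]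
  · simp [residual, ind, hA, Set.indicator]

/-- The conditional means of the influence function given the strata, with and without the
annotation indicator, agree. -/
lemma condExp_eif [IsProbabilityMeasure P] (hπ : Overlap π η) (hP : P ∈ model π)
    (hG : IsRegression Obs.G P muG) (hC : IsRegression Obs.C P muC) :
    P[eif P π muG muC | annotatedStrata k l] =ᵐ[P] P[eif P π muG muC | strataInfo k l] := by
  set σ : Feat k l × Bool × Bool → ℝ := strataPart (P.real {w | w.G}) (P.real {w | w.C})
        (∫ w, muG w.feat ∂P[|{w | w.G}] - ∫ w, muC w.feat ∂P[|{w | w.C}]) muG muC with hσ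
  have hG1 := hG.1
  have hC1 := hC.1
  have hσm : Measurable σ := by
    rw [hσ]; unfold strataPart; fun_prop
  have iG := ((memLp_residual hπ hP isGroup_G hG).integrable one_le_two).const_mul
    (P.real {w | w.G})⁻¹
  have iC := ((memLp_residual hπ hP isGroup_C hC).integrable one_le_two).const_mul
    (P.real {w | w.C})⁻¹
  have iφ := (memLp_eif hπ hP hG hC).integrable one_le_two
  have hφ : eif P π muG muC = ((fun w => (P.real {w | w.G})⁻¹ * residual π Obs.G muG w)
      - fun w => (P.real {w | w.C})⁻¹ * residual π Obs.C muC w) + fun w => σ w.strata :=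
    funext fun w => eif_eq w
  have iσ : Integrable (fun w => σ w.strata) P := by
    have : (fun w => σ w.strata) = eif P π muG muC
        - ((fun w => (P.real {w | w.G})⁻¹ * residual π Obs.G muG w)
        - fun w => (P.real {w | w.C})⁻¹ * residual π Obs.C muC w) := by rw [hφ]; abel
    rw [this]
    exact iφ.sub (iG.sub iC)
  have hsm : StronglyMeasurable[strataInfo k l] fun w => σ w.strata :=
    (hσm.comp (comap_measurable Obs.strata)).stronglyMeasurable
  have h1 : P[eif P π muG muC | annotatedStrata k l] =ᵐ[P] fun w => σ w.strata := by
    rw [hφ]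
    have a := condExp_add (iG.sub iC) iσ (annotatedStrata k l)
    have b := condExp_sub iG iC (annotatedStrata k l)
    have c := condExp_smul (μ := P) (P.real {w | w.G})⁻¹ (residual π Obs.G muG)
      (annotatedStrata k l)
    have d := condExp_smul (μ := P) (P.real {w | w.C})⁻¹ (residual π Obs.C muC)
      (annotatedStrata k l)
    have f := condExp_of_stronglyMeasurable annotatedStrata_le
      (hsm.mono strataInfo_le_annotatedStrata) iσ
    filter_upwards [a, b, c, d, condExp_residual hπ hP isGroup_G hG,
      condExp_residual hπ hP isGroup_C hC] with w a b c d e1 e2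
    rw [a, Pi.add_apply, b, Pi.sub_apply, f]
    change P[(P.real {w | w.G})⁻¹ • residual π Obs.G muG | annotatedStrata k l] w
      - P[(P.real {w | w.C})⁻¹ • residual π Obs.C muC | annotatedStrata k l] w + _ = _
    rw [c, d, Pi.smul_apply, Pi.smul_apply, e1, e2]
    simp
  -- The first conditional mean is already a function of the strata, so by the tower property
  -- conditioning it on the strata changes nothing.
  have h2 := condExp_condExp_of_le (μ := P) (f := eif P π muG muC)
    strataInfo_le_annotatedStrata annotatedStrata_le
  have h3 := condExp_congr_ae (m := strataInfo k l) h1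
  rw [condExp_of_stronglyMeasurable strataInfo_le hsm iσ] at h3
  filter_upwards [h1, h2, h3] with w a b c
  rw [a, ← b, c]

end DiD

/-! ### Projection onto the tangent space and efficiency -/

namespace DiD

open Semiparametric

variable {k l : ℕ} {π : (Fin 2 → Fin k → ℝ) → ℝ} {η : ℝ} {P : Measure (Obs k l)}
  {muG muC : Feat k l → ℝ}

/-- Projection of a function of the observed data onto the tangent space of the model. -/
noncomputable def tangentProj (P : Measure (Obs k l)) (u : Obs k l → ℝ) : Obs k l → ℝ :=
  u - P[u | annotatedStrata k l] + P[u | strataInfo k l] - P[u | (⊥ : MeasurableSpace (Obs k l))]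

lemma measurable_tangentProj {u : Obs k l → ℝ} (hu : Measurable u) :
    Measurable (tangentProj P u) :=
  ((hu.sub (stronglyMeasurable_condExp.measurable.mono annotatedStrata_le le_rfl)).add
    (stronglyMeasurable_condExp.measurable.mono strataInfo_le le_rfl)).sub
    (stronglyMeasurable_condExp.measurable.mono bot_le le_rfl)

lemma abs_tangentProj_le {u : Obs k l → ℝ} {c : ℝ≥0} (hc : ∀ w, |u w| ≤ c) :
    ∀ᵐ w ∂P, |tangentProj P u w| ≤ 4 * c := by
  have hb : ∀ᵐ w ∂P, |u w| ≤ (c : ℝ) := .of_forall hc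
  filter_upwards [ae_bdd_abs_condExp_of_ae_bdd_abs (m := annotatedStrata k l) hb,
    ae_bdd_abs_condExp_of_ae_bdd_abs (m := strataInfo k l) hb,
    ae_bdd_abs_condExp_of_ae_bdd_abs (m := (⊥ : MeasurableSpace (Obs k l))) hb] with w h1 h2 h3
  have h0 := hc w
  simp only [tangentProj, Pi.sub_apply, Pi.add_apply]
  rw [abs_le] at *
  constructor <;> linarith [h0.1, h0.2, h1.1, h1.2, h2.1, h2.2, h3.1, h3.2]

lemma integral_tangentProj [IsProbabilityMeasure P] {u : Obs k l → ℝ} (hu : Integrable u P) :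
    ∫ w, tangentProj P u w ∂P = 0 := by
  simp only [tangentProj, Pi.sub_apply, Pi.add_apply]
  have i1 : Integrable (fun w => u w - (P[u | annotatedStrata k l]) w) P :=
    hu.sub integrable_condExp
  have i2 : Integrable (fun w => u w - (P[u | annotatedStrata k l]) w
      + (P[u | strataInfo k l]) w) P := i1.add integrable_condExp
  rw [integral_sub i2 integrable_condExp, integral_add i1 integrable_condExp,
    integral_sub hu integrable_condExp, integral_condExp annotatedStrata_le,
    integral_condExp strataInfo_le, integral_condExp bot_le]
  ring

/-- The factor (A - π) 1_B(S) is a function of (S, A), so it integrates to zero against u - E[u | S,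
A]. It has mean zero given S, so it also integrates to zero against E[u | S] and the constant. -/
lemma setIntegral_residual_mul_tangentProj [IsProbabilityMeasure P] (hπ : Overlap π η) (hP : Scored π P)
    {u : Obs k l → ℝ} (hu : Integrable u P) {B : Set (Feat k l × Bool × Bool)}
    (hB : MeasurableSet B) :
    ∫ w in Obs.strata ⁻¹' B, (ind w.A - π w.X) * tangentProj P u w ∂P = 0 := by
  have hm := hπ.measurable
  let b : Feat k l × Bool × Bool → ℝ := B.indicator fun _ => 1
  have hb : Measurable b := measurable_const.indicator hB
  let κ : (Feat k l × Bool × Bool) × Bool → ℝ := fun v => (ind v.2 - π v.1.1.1) * b v.1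
  have hκ : Measurable κ := by fun_prop
  have hκ1 : ∀ w : Obs k l, |κ (w.strata, w.A)| ≤ 1 := fun w => by
    change |(ind w.A - π w.X) * b w.strata| ≤ 1
    rw [abs_mul]
    refine (mul_le_of_le_one_right (abs_nonneg _) ?_).trans (abs_ind_sub_score_le hπ w)
    by_cases hw : w.strata ∈ B <;> simp [b, hw]
  have iκ : ∀ f : Obs k l → ℝ, Integrable f P →
      Integrable (fun w => κ (w.strata, w.A) * f w) P := fun f hf =>
    hf.bdd_mul (c := 1) (Measurable.aestronglyMeasurable (by fun_prop)) (.of_forall hκ1)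
  have h1 := integral_mul_condExp annotatedStrata_le (μ := P) (f := u)
    (hκ.comp (comap_measurable fun w : Obs k l => (w.strata, w.A))).stronglyMeasurable
    (iκ u hu) hu
  have h2 : ∀ v : Obs k l → ℝ, StronglyMeasurable[strataInfo k l] v → Integrable v P →
      ∫ w, κ (w.strata, w.A) * v w ∂P = 0 := by
    intro v hv hvi
    obtain ⟨r, hr, rfl⟩ := hv.exists_eq_measurable_comp
    have hrm := hr.measurable
    rw [← hP.integral_residual_eq_zero hπ (b := fun x => b x * r x) (by fun_prop) ?_]
    · refine integral_congr_ae (.of_forall fun w => ?_)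
      change (ind w.A - π w.X) * b w.strata * r w.strata = _
      ring
    · refine hvi.bdd_mul (c := 1) (Measurable.aestronglyMeasurable (by fun_prop))
        (.of_forall fun w => ?_)
      by_cases hw : w.strata ∈ B <;> simp [b, hw]
  have e : ∀ w, (Obs.strata ⁻¹' B).indicator (fun w => (ind w.A - π w.X) * tangentProj P u w) w
      = κ (w.strata, w.A) * u w - κ (w.strata, w.A) * (P[u | annotatedStrata k l]) w
        + κ (w.strata, w.A) * (P[u | strataInfo k l]) w
        - κ (w.strata, w.A) * (P[u | (⊥ : MeasurableSpace (Obs k l))]) w := by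
    intro w
    have hκw : κ (w.strata, w.A) = (ind w.A - π w.X) * b w.strata := rfl
    rw [hκw]
    by_cases hw : w.strata ∈ B
    · simp only [Set.indicator, Set.mem_preimage, hw, if_true, b, tangentProj, Pi.sub_apply,
        Pi.add_apply]
      ring
    · simp [Set.indicator, hw, b]
  rw [← integral_indicator (Obs.measurable_strata hB)]
  simp_rw [e]
  have j1 := iκ u hu
  have j2 := iκ _ (integrable_condExp (μ := P) (f := u) (m := annotatedStrata k l))
  have j3 := iκ _ (integrable_condExp (μ := P) (f := u) (m := strataInfo k l))
  have j4 := iκ _ (integrable_condExp (μ := P) (f := u) (m := (⊥ : MeasurableSpace (Obs k l))))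
  have j12 : Integrable (fun w => κ (w.strata, w.A) * u w
      - κ (w.strata, w.A) * (P[u | annotatedStrata k l]) w) P := j1.sub j2
  have j123 : Integrable (fun w => κ (w.strata, w.A) * u w
      - κ (w.strata, w.A) * (P[u | annotatedStrata k l]) w
      + κ (w.strata, w.A) * (P[u | strataInfo k l]) w) P := j12.add j3
  rw [integral_sub j123 j4, integral_add j12 j3, integral_sub j1 j2,
    h2 _ stronglyMeasurable_condExp integrable_condExp,
    h2 _ (stronglyMeasurable_condExp.mono bot_le) integrable_condExp]
  simp only [Function.comp_apply] at h1
  rw [h1]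
  ring

/-- Projections of bounded functions are scores of regular submodels. -/
lemma tangentProj_mem_tangentSet [IsProbabilityMeasure P] (hπ : Overlap π η) (hP : P ∈ model π) {u : Obs k l → ℝ}
    (hu : Measurable u) {c : ℝ≥0} (hc : ∀ w, |u w| ≤ c) :
    tangentProj P u ∈ tangentSet (regularPaths π) P := by
  have hi : Integrable u P := Integrable.of_bound hu.aestronglyMeasurable c (.of_forall hc)
  have hm := measurable_tangentProj (P := P) hu
  have hb := abs_tangentProj_le (P := P) hc
  have h0 := integral_tangentProj hi
  exact ⟨linearPath P (tangentProj P u), linearPath_mem_regularPaths hπ hP hm hb h0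
    fun B hB => setIntegral_residual_mul_tangentProj hπ ((scored_iff hπ _).2 hP.2.2.2.2) hi hB,
    isQMDPath_linearPath hm hb h0⟩

/-- Each of the four terms is bounded by the norm of `u`. The constant is crude, but any Lipschitz
bound serves the density argument. -/
lemma eLpNorm_tangentProj_le [IsProbabilityMeasure P] {u : Obs k l → ℝ} (hu : MemLp u 2 P) :
    eLpNorm (tangentProj P u) 2 P ≤ 4 * eLpNorm u 2 P := by
  have h : ∀ m : MeasurableSpace (Obs k l), eLpNorm (P[u | m]) 2 P ≤ eLpNorm u 2 P :=
    fun m => eLpNorm_condExp_le_eLpNorm u one_le_two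
  have m1 : AEStronglyMeasurable (P[u | annotatedStrata k l]) P :=
    integrable_condExp.aestronglyMeasurable
  have m2 : AEStronglyMeasurable (P[u | strataInfo k l]) P :=
    integrable_condExp.aestronglyMeasurable
  have m3 : AEStronglyMeasurable (P[u | (⊥ : MeasurableSpace (Obs k l))]) P :=
    integrable_condExp.aestronglyMeasurable
  calc eLpNorm (tangentProj P u) 2 P
      ≤ eLpNorm (u - P[u | annotatedStrata k l] + P[u | strataInfo k l]) 2 P
        + eLpNorm (P[u | (⊥ : MeasurableSpace (Obs k l))]) 2 P :=
        eLpNorm_sub_le ((hu.1.sub m1).add m2) m3 one_le_two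
    _ ≤ (eLpNorm (u - P[u | annotatedStrata k l]) 2 P + eLpNorm (P[u | strataInfo k l]) 2 P)
        + eLpNorm (P[u | (⊥ : MeasurableSpace (Obs k l))]) 2 P := by
        gcongr; exact eLpNorm_add_le (hu.1.sub m1) m2 one_le_two
    _ ≤ ((eLpNorm u 2 P + eLpNorm (P[u | annotatedStrata k l]) 2 P)
        + eLpNorm (P[u | strataInfo k l]) 2 P)
        + eLpNorm (P[u | (⊥ : MeasurableSpace (Obs k l))]) 2 P := by
        gcongr; exact eLpNorm_sub_le hu.1 m1 one_le_two
    _ ≤ ((eLpNorm u 2 P + eLpNorm u 2 P) + eLpNorm u 2 P) + eLpNorm u 2 P := by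
        gcongr <;> exact h _
    _ = 4 * eLpNorm u 2 P := by ring

/-- The influence function lies in the closed linear span of the tangent set. -/
lemma exists_mem_span_eLpNorm_lt [IsProbabilityMeasure P] (hπ : Overlap π η) (hP : P ∈ model π)
    (hG : IsRegression Obs.G P muG) (hC : IsRegression Obs.C P muC)
    (hpG : P {w | w.G} ≠ 0) (hpC : P {w | w.C} ≠ 0) {ε : ℝ≥0∞} (hε : 0 < ε) :
    ∃ s ∈ Submodule.span ℝ (tangentSet (regularPaths π) P),
      eLpNorm (eif P π muG muC - s) 2 P < ε := by
  set φ := eif P π muG muC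
  have hφ : MemLp φ 2 P := memLp_eif hπ hP hG hC
  have iφ := hφ.integrable one_le_two
  -- The tolerance ε / 4 compensates the Lipschitz constant 4 of the projection.
  obtain ⟨u, hu, huL⟩ := hφ.exists_simpleFunc_eLpNorm_sub_lt (by simp)
    (ε := ε / 4) (ENNReal.div_pos hε.ne' (by simp)).ne'
  obtain ⟨c, hc⟩ := u.exists_forall_norm_le
  have iu := huL.integrable one_le_two
  have hc' : ∀ w, |u w| ≤ c.toNNReal := fun w => (hc w).trans (Real.le_coe_toNNReal c)
  refine ⟨tangentProj P u, Submodule.subset_span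
    (tangentProj_mem_tangentSet hπ hP u.measurable hc'), ?_⟩
  have hbot : P[φ | (⊥ : MeasurableSpace (Obs k l))] = fun _ => 0 := by
    rw [condExp_bot]
    exact funext fun _ => integral_eif hπ hP hG hC hpG hpC
  -- The projection fixes φ: its conditional means given (S, A) and given S cancel, and its mean is
  -- zero. Linearity does the rest.
  have hae : φ - tangentProj P u =ᵐ[P] tangentProj P (φ - ⇑u) := by
    filter_upwards [condExp_sub iφ iu (annotatedStrata k l), condExp_sub iφ iu (strataInfo k l),
      condExp_sub iφ iu (⊥ : MeasurableSpace (Obs k l)), condExp_eif hπ hP hG hC] with w a b c d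
    simp only [tangentProj, Pi.sub_apply, Pi.add_apply] at *
    rw [a, b, c, d, hbot]
    ring
  rw [eLpNorm_congr_ae hae]
  refine (eLpNorm_tangentProj_le (hφ.sub huL)).trans_lt ?_
  calc 4 * eLpNorm (φ - ⇑u) 2 P < 4 * (ε / 4) :=
        (ENNReal.mul_lt_mul_iff_right (by simp) (by simp)).2 hu
    _ = ε := ENNReal.mul_div_cancel (by simp) (by simp)

/-- Pathwise derivative of the identified functional. -/
lemma tendsto_identified [IsProbabilityMeasure P] (hπ : Overlap π η) (hP : P ∈ model π)
    (hG : IsRegression Obs.G P muG) (hC : IsRegression Obs.C P muC)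
    {Q : ℝ → Measure (Obs k l)} (hreg : Q ∈ regularPaths π)
    {h : Obs k l → ℝ} (hQ : IsQMDPath P Q h) :
    Tendsto (fun t : ℝ => (identified (P.real {w | w.G}) (P.real {w | w.C}) (Q t)
      - identified (P.real {w | w.G}) (P.real {w | w.C}) P) / t) (𝓝[>] 0)
      (𝓝 (∫ w, eif P π muG muC w * h w ∂P)) := by
  have hm := hπ.measurable
  have hS := (scored_iff hπ _).2 hP.2.2.2.2
  have hG1 := hG.1
  have hC1 := hC.1
  have hh := hQ.2.1
  set pG := P.real {w | w.G}
  set pC := P.real {w | w.C}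
  set c := ∫ w, muG w.feat ∂P[|{w | w.G}] - ∫ w, muC w.feat ∂P[|{w | w.C}] with hc
  obtain ⟨B, hB⟩ := hreg.2
  have hlim := hQ.tendsto_diffQuotient (hreg.1.mono fun t ht => ht.1)
    (measurable_ipwContrast hm pG pC) (memLp_ipwContrast hπ pG pC hP.2.2.2.1)
    (((η⁻¹ * (|pG⁻¹| + |pC⁻¹|)) ^ 2).toNNReal * B) (hB.mono fun t ht =>
      (lintegral_sq_ipwContrast_le hπ pG pC (Q t)).trans (by
        rw [ENNReal.coe_mul]; exact mul_le_mul_right ht _))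
  -- Chosen so that φ = f - (A - π) σ(S) - c, with f the inverse-weighted contrast and c the
  -- difference of the two group means of the regressions.
  let σ : Feat k l × Bool × Bool → ℝ := fun v =>
    (π v.1.1)⁻¹ * (pG⁻¹ * (sel (true, false) v * muG v.1) - pC⁻¹ * (sel (false, true) v * muC v.1))
  have hσ : Measurable σ := by fun_prop
  have hσL : MemLp (fun w : Obs k l => σ w.strata) 2 P := by
    have h1 := ((memLp_group_mul hπ hP isGroup_G hG).const_mul pG⁻¹).sub
      ((memLp_group_mul hπ hP isGroup_C hC).const_mul pC⁻¹)
    refine (memLp_bdd_mul (u := fun w => (π w.X)⁻¹) (c := η⁻¹) h1 (by fun_prop)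
      fun w => hπ.abs_inv_le _).ae_eq (.of_forall fun w => ?_)
    simp only [σ, isGroup_G.sel_strata, isGroup_C.sel_strata, Pi.sub_apply]
    rfl
  have horth := integral_residual_mul_score_eq_zero hπ hS hreg hQ hσ hσL
  have hzero := integral_score_eq_zero hreg hQ
  have hdec : ∀ w, eif P π muG muC w * h w = ipwContrast π pG pC w * h w
      - ((ind w.A - π w.X) * σ w.strata) * h w - c * h w := by
    intro w
    have hne := (hπ.pos' w.X).ne'
    have hσw : σ w.strata = (π w.X)⁻¹ * (pG⁻¹ * (ind w.G * muG w.feat)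
        - pC⁻¹ * (ind w.C * muC w.feat)) := by
      simp only [σ, isGroup_G.sel_strata, isGroup_C.sel_strata]
      rfl
    rw [hσw]
    simp only [eif, influence, aipw, ipwContrast, hc]
    simp only [pG, pC]
    field_simp
    ring
  have i1 : Integrable (fun w => ipwContrast π pG pC w * h w) P :=
    (memLp_ipwContrast hπ pG pC hP.2.2.2.1).integrable_mul hh
  have i2 : Integrable (fun w => ((ind w.A - π w.X) * σ w.strata) * h w) P :=
    (memLp_bdd_mul (u := fun w : Obs k l => ind w.A - π w.X) (c := 1) hσL (by fun_prop)
      (abs_ind_sub_score_le hπ)).integrable_mul hh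
  have i3 := (hh.integrable one_le_two).const_mul c
  have hval : ∫ w, eif P π muG muC w * h w ∂P = ∫ w, ipwContrast π pG pC w * h w ∂P := by
    simp_rw [hdec]
    have i12 : Integrable (fun w => ipwContrast π pG pC w * h w
      - ((ind w.A - π w.X) * σ w.strata) * h w) P := i1.sub i2
    rw [integral_sub i12 i3, integral_sub i1 i2, horth, integral_const_mul, hzero]
    simp
  rw [hval]
  refine hlim.congr' (hreg.1.mono fun t ht => ?_)
  have := ht.1
  simp only [identified_eq_integral hπ hS hP.2.2.2.1,
    identified_eq_integral hπ ((scored_iff hπ _).2 ht.2.2.2.2) ht.2.2.2.1]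

theorem isEfficientInfluenceFunction_eif [IsProbabilityMeasure P] (hπ : Overlap π η) (hP : P ∈ model π)
    (hG : IsRegression Obs.G P muG) (hC : IsRegression Obs.C P muC)
    (hpG : P {w | w.G} ≠ 0) (hpC : P {w | w.C} ≠ 0) :
    IsEfficientInfluenceFunction (regularPaths π)
      (identified (P.real {w | w.G}) (P.real {w | w.C})) P (eif P π muG muC) :=
  ⟨memLp_eif hπ hP hG hC, fun _ hreg _ hQ => tendsto_identified hπ hP hG hC hreg hQ,
    fun _ hε => exists_mem_span_eLpNorm_lt hπ hP hG hC hpG hpC hε⟩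

end DiD

/-! ### Limit theorems for iid sums over finite index sets -/

section Limit

variable {Ω : Type*} [MeasurableSpace Ω] {ρ : Measure Ω} [IsProbabilityMeasure ρ]

/-- The law of a finite sum of iid variables depends on the index set through its size only. -/
lemma map_finsetSum_eq_of_card_eq {X : ℕ → Ω → ℝ} (hindep : iIndepFun X ρ)
    (hident : ∀ i, IdentDistrib (X i) (X 0) ρ ρ) {s t : Finset ℕ} (h : s.card = t.card) :
    ρ.map (fun ω => ∑ i ∈ s, X i ω) = ρ.map (fun ω => ∑ i ∈ t, X i ω) := by
  have mX n := (hident n).aemeasurable_fst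
  have hm : ∀ s : Finset ℕ, AEMeasurable (fun ω => ∑ i ∈ s, X i ω) ρ := fun s =>
    Finset.aemeasurable_fun_sum _ fun _ _ => mX _
  have := Measure.isProbabilityMeasure_map (hm s)
  have := Measure.isProbabilityMeasure_map (hm t)
  refine Measure.ext_of_charFun ?_
  rw [(hindep.restrict _).charFun_map_fun_finsetSum_eq_prod (fun _ _ => mX _),
    (hindep.restrict _).charFun_map_fun_finsetSum_eq_prod (fun _ _ => mX _)]
  simp only [(hident _).map_eq, Finset.prod_const, h]

/-- Central limit theorem along finite index sets of increasing size. -/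
lemma tendstoInDistribution_finset {X : ℕ → Ω → ℝ} (hX : MemLp (X 0) 2 ρ)
    (hmean : ∫ ω, X 0 ω ∂ρ = 0) (hindep : iIndepFun X ρ)
    (hident : ∀ i, IdentDistrib (X i) (X 0) ρ ρ) {I : ℕ → Finset ℕ}
    (hI : Tendsto (fun N => (I N).card) atTop atTop) :
    TendstoInDistribution (fun N ω => (√((I N).card : ℝ))⁻¹ * ∑ i ∈ I N, X i ω) atTop
      (id : ℝ → ℝ) (fun _ => ρ) (gaussianReal 0 Var[X 0; ρ].toNNReal) := by
  have mX n := (hident n).aemeasurable_fst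
  have hsum : ∀ s : Finset ℕ, AEMeasurable (fun ω => ∑ i ∈ s, X i ω) ρ := fun s =>
    Finset.aemeasurable_fun_sum _ fun _ _ => mX _
  -- The central limit theorem is applied to initial segments; each index set is then exchanged for
  -- the segment of the same size, which leaves the law of the sum unchanged.
  have h := tendstoInDistribution_inv_sqrt_mul_sum_sub
    (Y := (id : ℝ → ℝ)) (P' := gaussianReal 0 Var[X 0; ρ].toNNReal) HasLaw.id hX hindep hident
  simp only [hmean, mul_zero, sub_zero] at h
  refine ⟨fun N => (hsum _).const_mul _, aemeasurable_id, ?_⟩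
  refine (h.tendsto.comp hI).congr fun N => Subtype.ext ?_
  have e : ∀ s : Finset ℕ, ρ.map (fun ω => (√((I N).card : ℝ))⁻¹ * ∑ i ∈ s, X i ω)
      = (ρ.map fun ω => ∑ i ∈ s, X i ω).map fun x => (√((I N).card : ℝ))⁻¹ * x := fun s => by
    rw [AEMeasurable.map_map_of_aemeasurable (by fun_prop) (hsum s)]; rfl
  change ρ.map (fun ω => (√((I N).card : ℝ))⁻¹ * ∑ i ∈ Finset.range (I N).card, X i ω)
    = ρ.map fun ω => (√((I N).card : ℝ))⁻¹ * ∑ i ∈ I N, X i ω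
  rw [e, e, map_finsetSum_eq_of_card_eq hindep hident (s := Finset.range (I N).card)
    (t := I N) (by simp)]

/-- Conditioning on one of two independent variables. -/
lemma lintegral_indepFun_prod {α β : Type*} [MeasurableSpace α] [MeasurableSpace β]
    {U : Ω → α} {V : Ω → β} (hU : Measurable U) (hV : Measurable V) (hUV : IndepFun U V ρ)
    {f : α → β → ℝ≥0∞} (hf : Measurable (Function.uncurry f)) :
    ∫⁻ ω, f (U ω) (V ω) ∂ρ = ∫⁻ ω', ∫⁻ ω, f (U ω') (V ω) ∂ρ ∂ρ := by
  have h1 : ∫⁻ ω, f (U ω) (V ω) ∂ρ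
      = ∫⁻ z, Function.uncurry f z ∂(ρ.map fun ω => (U ω, V ω)) := by
    rw [lintegral_map hf (hU.prodMk hV)]; rfl
  have := Measure.isProbabilityMeasure_map (μ := ρ) hV.aemeasurable
  rw [h1, (indepFun_iff_map_prod_eq_prod_map_map hU.aemeasurable hV.aemeasurable).1 hUV,
    lintegral_prod _ hf.aemeasurable, lintegral_map hf.lintegral_prod_right' hU]
  refine lintegral_congr fun ω' => ?_
  exact lintegral_map (f := fun y => Function.uncurry f (U ω', y))
    (hf.comp measurable_prodMk_left) hV

/-- Second moment of a sum of centred iid variables. -/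
lemma lintegral_sq_finsetSum {α : Type*} [MeasurableSpace α] {P : Measure α} {W : ℕ → Ω → α}
    (hWm : ∀ i, Measurable (W i)) (hW : ∀ i, ρ.map (W i) = P) (hind : iIndepFun W ρ)
    {f : α → ℝ} (hf : Measurable f) (hfL : MemLp f 2 P) (h0 : ∫ a, f a ∂P = 0) (s : Finset ℕ) :
    ∫⁻ ω, ENNReal.ofReal ((∑ i ∈ s, f (W i ω)) ^ 2) ∂ρ
      = s.card * ENNReal.ofReal (∫ a, f a ^ 2 ∂P) := by
  have hL : ∀ i, MemLp (fun ω => f (W i ω)) 2 ρ := fun i => by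
    rw [← hW i] at hfL
    exact hfL.comp_of_map (hWm i).aemeasurable
  have hmean : ∀ i, ∫ ω, f (W i ω) ∂ρ = 0 := fun i => by
    rw [← h0, ← hW i, integral_map (hWm i).aemeasurable hf.aestronglyMeasurable]
  have hvar : ∀ i, Var[fun ω => f (W i ω); ρ] = ∫ a, f a ^ 2 ∂P := fun i => by
    rw [variance_of_integral_eq_zero (hL i).1.aemeasurable (hmean i), ← hW i,
      integral_map (hWm i).aemeasurable (hf.pow_const 2).aestronglyMeasurable]
  have hsum := IndepFun.variance_sum (s := s) (X := fun i ω => f (W i ω)) (fun i _ => hL i)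
    (fun i _ j _ hij => (hind.indepFun hij).comp hf hf)
  have hsL : MemLp (∑ i ∈ s, fun ω => f (W i ω)) 2 ρ := memLp_finsetSum' s fun i _ => hL i
  have hs0 : ∫ ω, (∑ i ∈ s, fun ω => f (W i ω)) ω ∂ρ = 0 := by
    simp only [Finset.sum_apply]
    rw [integral_finsetSum _ fun i _ => (hL i).integrable one_le_two]
    simp [hmean]
  rw [variance_of_integral_eq_zero hsL.1.aemeasurable hs0] at hsum
  simp only [hvar, Finset.sum_const, nsmul_eq_mul] at hsum
  have := ofReal_integral_eq_lintegral_ofReal hsL.integrable_sq (.of_forall fun _ => sq_nonneg _)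
  rw [hsum, ENNReal.ofReal_mul (by positivity), ENNReal.ofReal_natCast] at this
  rw [this]
  simp only [Finset.sum_apply]

end Limit

/-! ### The effect of estimating the regressions -/

namespace DiD

variable {k l : ℕ} {π : (Fin 2 → Fin k → ℝ) → ℝ} {η : ℝ} {P : Measure (Obs k l)}
  {g : Obs k l → Bool} {e : Bool × Bool} {mu : Feat k l → ℝ}

/-- The effect on the estimator of an error `δ` of the imputation function. -/
noncomputable def imputationError (π : (Fin 2 → Fin k → ℝ) → ℝ) (g : Obs k l → Bool) (p : ℝ)
    (δ : Feat k l → ℝ) (w : Obs k l) : ℝ :=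
  p⁻¹ * (1 - ind w.A * (π w.X)⁻¹) * (ind (g w) * δ w.feat)

lemma aipw_sub_aipw (p : ℝ) (nu mu : Feat k l → ℝ) (w : Obs k l) :
    aipw π g p nu w - aipw π g p mu w = imputationError π g p (fun x => nu x - mu x) w := by
  unfold aipw imputationError; ring

/-- Without annotation the value is 1 ≤ 1/η; with annotation it is 1 - 1/π, between 1 - 1/η and 0.
-/
lemma Overlap.abs_one_sub_le (hπ : Overlap π η) (w : Obs k l) :
    |1 - ind w.A * (π w.X)⁻¹| ≤ η⁻¹ := by
  have h1 := hπ.abs_inv_le w.X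
  have h2 : 1 ≤ (π w.X)⁻¹ := one_le_inv_iff₀.2 ⟨hπ.pos' _, hπ.le_one _⟩
  rw [abs_of_pos (by linarith)] at h1
  cases hA : w.A
  · simpa [ind] using h2.trans h1
  · rw [ind_true, one_mul, abs_le]
    constructor <;> linarith

lemma abs_imputationError_le (hπ : Overlap π η) (p : ℝ) (δ : Feat k l → ℝ) (w : Obs k l) :
    |imputationError π g p δ w| ≤ |p⁻¹| * η⁻¹ * |δ w.feat| := by
  rw [imputationError, abs_mul, abs_mul, abs_mul, abs_of_nonneg (ind_nonneg _)]
  have := hπ.pos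
  refine mul_le_mul ?_ (mul_le_of_le_one_left (abs_nonneg _) (ind_le_one _))
    (mul_nonneg (ind_nonneg _) (abs_nonneg _)) (by positivity)
  exact mul_le_mul_of_nonneg_left (hπ.abs_one_sub_le w) (abs_nonneg _)

lemma measurable_imputationError (hπ : Measurable π) (hg : Measurable g) (p : ℝ)
    {δ : Feat k l → ℝ} (hδ : Measurable δ) : Measurable (imputationError π g p δ) := by
  unfold imputationError; fun_prop

/-- Since 1 - A/π = -(A - π)/π, the error is the annotation residual times a function of the strata.
It is centred for every integrable δ, however poor the imputation. -/
lemma integral_imputationError [IsFiniteMeasure P] (hπ : Overlap π η) (hP : Scored π P)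
    (hg : IsGroup g e) (p : ℝ) {δ : Feat k l → ℝ} (hδ : Measurable δ)
    (hδi : Integrable (fun w : Obs k l => δ w.feat) P) :
    ∫ w, imputationError π g p δ w ∂P = 0 := by
  have hm := hπ.measurable
  have hgm := hg.measurable
  let b : Feat k l × Bool × Bool → ℝ := fun v => -p⁻¹ * (π v.1.1)⁻¹ * (sel e v * δ v.1)
  have hb : ∀ w : Obs k l, b w.strata = (-p⁻¹ * (π w.X)⁻¹ * ind (g w)) * δ w.feat := fun w => by
    rw [← hg.sel_strata]
    change -p⁻¹ * (π w.X)⁻¹ * (_ * δ w.feat) = _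
    ring
  have hbi : Integrable (fun w : Obs k l => b w.strata) P := by
    simp_rw [hb]
    refine hδi.bdd_mul (c := |p⁻¹| * η⁻¹) (Measurable.aestronglyMeasurable (by fun_prop))
      (.of_forall fun w => ?_)
    rw [Real.norm_eq_abs, abs_mul, abs_mul, abs_neg, abs_of_nonneg (ind_nonneg _)]
    exact (mul_le_of_le_one_right (by positivity) (ind_le_one _)).trans
      (mul_le_mul_of_nonneg_left (hπ.abs_inv_le _) (abs_nonneg _))
  rw [← hP.integral_residual_eq_zero hπ (b := b) (by fun_prop) hbi]
  refine integral_congr_ae (.of_forall fun w => ?_)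
  have := (hπ.pos' w.X).ne'
  simp only [imputationError, hb]
  field_simp
  ring

/-- Second moment of the accumulated effect of a fixed imputation error. -/
lemma lintegral_sq_imputationError_le [IsProbabilityMeasure P] (hπ : Overlap π η)
    (hP : Scored π P) (hg : IsGroup g e) {p : ℝ} (hp : p ≠ 0) {δ : Feat k l → ℝ}
    (hδ : Measurable δ) {Ω : Type*} [MeasurableSpace Ω] {ρ : Measure Ω} [IsProbabilityMeasure ρ]
    {W : ℕ → Ω → Obs k l} (hWm : ∀ i, Measurable (W i)) (hW : ∀ i, ρ.map (W i) = P)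
    (hind : iIndepFun W ρ) (s : Finset ℕ) :
    ∫⁻ ω, ENNReal.ofReal ((∑ i ∈ s, imputationError π g p δ (W i ω)) ^ 2) ∂ρ
      ≤ s.card * (ENNReal.ofReal ((|p⁻¹| * η⁻¹) ^ 2)
        * ∫⁻ x, ENNReal.ofReal (δ x ^ 2) ∂(P.map Obs.feat)) := by
  have hm := hπ.measurable
  have hη := hπ.pos
  have hξm := measurable_imputationError hm hg.measurable p hδ
  rcases s.eq_empty_or_nonempty with rfl | hs
  · simp
  have hmap : ∫⁻ x, ENNReal.ofReal (δ x ^ 2) ∂(P.map Obs.feat)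
      = ∫⁻ w, ENNReal.ofReal (δ w.feat ^ 2) ∂P :=
    lintegral_map (by fun_prop) Obs.measurable_feat
  -- If δ is not square integrable, the right side is infinite, because the constant is positive and
  -- `s` is nonempty.
  by_cases htop : ∫⁻ x, ENNReal.ofReal (δ x ^ 2) ∂(P.map Obs.feat) = ∞
  · have h1 : 0 < (|p⁻¹| * η⁻¹) ^ 2 := by positivity
    rw [htop, ENNReal.mul_top (ENNReal.ofReal_pos.2 h1).ne', ENNReal.mul_top (by simp [hs.ne_empty])]
    exact le_top
  have hδL : MemLp (fun w : Obs k l => δ w.feat) 2 P := by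
    have hδf : Measurable fun w : Obs k l => δ w.feat := hδ.comp Obs.measurable_feat
    rw [memLp_two_iff_integrable_sq hδf.aestronglyMeasurable]
    refine ⟨(hδf.pow_const 2).aestronglyMeasurable, ?_⟩
    rw [hasFiniteIntegral_iff_ofReal (.of_forall fun _ => sq_nonneg _), ← hmap]
    exact lt_top_iff_ne_top.2 htop
  have hξL : MemLp (imputationError π g p δ) 2 P :=
    hδL.of_le_mul (c := |p⁻¹| * η⁻¹) hξm.aestronglyMeasurable
      (.of_forall fun w => abs_imputationError_le hπ p δ w)
  rw [lintegral_sq_finsetSum hWm hW hind hξm hξL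
    (integral_imputationError hπ hP hg p hδ (hδL.integrable one_le_two))]
  gcongr
  rw [hmap, ofReal_integral_eq_lintegral_ofReal hξL.integrable_sq (.of_forall fun _ => sq_nonneg _),
    ← lintegral_const_mul _ (by fun_prop)]
  refine lintegral_mono fun w => ?_
  rw [← ENNReal.ofReal_mul (sq_nonneg _), ← mul_pow]
  refine ENNReal.ofReal_le_ofReal ?_
  rw [← sq_abs, ← sq_abs (_ * δ _), abs_mul _ (δ _), abs_of_nonneg (by positivity : 0 ≤ |p⁻¹| * η⁻¹)]
  exact pow_le_pow_left₀ (abs_nonneg _) (abs_imputationError_le hπ p δ w) 2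

section Sample

variable {Ω : Type*} [MeasurableSpace Ω] {ρ : Measure Ω} [IsProbabilityMeasure ρ]
  {W : ℕ → Ω → Obs k l}

/-- The normalized effect of the imputation errors, when the imputation function is estimated on an
independent sample. -/
noncomputable def remainder (π : (Fin 2 → Fin k → ℝ) → ℝ) (g : Obs k l → Bool) (p : ℝ)
    (mu : Feat k l → ℝ) (W : ℕ → Ω → Obs k l) (I I' : Finset ℕ)
    (muHat : (I' → Obs k l) → Feat k l → ℝ) (ω : Ω) : ℝ :=
  (√(I.card : ℝ))⁻¹ * ∑ i ∈ I,
    imputationError π g p (fun x => muHat (fun i => W i ω) x - mu x) (W i ω)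

lemma measurable_remainder (hπ : Measurable π) (hg : Measurable g) (hmu : Measurable mu) (p : ℝ)
    (hWm : ∀ i, Measurable (W i)) (I I' : Finset ℕ) {muHat : (I' → Obs k l) → Feat k l → ℝ}
    (hmuHat : Measurable (Function.uncurry muHat)) :
    Measurable (remainder π g p mu W I I' muHat) := by
  have h : ∀ i, Measurable fun ω => muHat (fun i => W i ω) (W i ω).feat := fun i =>
    hmuHat.comp ((measurable_pi_lambda _ fun i : I' => hWm i).prodMk
      (Obs.measurable_feat.comp (hWm i)))
  unfold remainder imputationError
  fun_prop

/-- The tuning data are independent of the estimation data, so they may be frozen: `muHat` becomes a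
fixed function, the summands are centred and iid, and the normalization cancels the |I| equal
variances. Averaging over the tuning data gives the mean squared error. -/
lemma lintegral_sq_remainder_le [IsProbabilityMeasure P] (hπ : Overlap π η)
    (hP : Scored π P) (hg : IsGroup g e) {p : ℝ} (hp : p ≠ 0) (hmu : Measurable mu)
    (hWm : ∀ i, Measurable (W i)) (hW : ∀ i, ρ.map (W i) = P) (hind : iIndepFun W ρ)
    {I I' : Finset ℕ} (hdisj : Disjoint I I') {muHat : (I' → Obs k l) → Feat k l → ℝ}
    (hmuHat : Measurable (Function.uncurry muHat)) :
    ∫⁻ ω, ENNReal.ofReal (remainder π g p mu W I I' muHat ω ^ 2) ∂ρ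
      ≤ ENNReal.ofReal ((|p⁻¹| * η⁻¹) ^ 2) * mse ρ P W I' muHat mu := by
  have hm := hπ.measurable
  have hgm := hg.measurable
  have hU : Measurable fun ω (i : I') => W i ω := measurable_pi_lambda _ fun i => hWm i
  have hV : Measurable fun ω (i : I) => W i ω := measurable_pi_lambda _ fun i => hWm i
  let f : (I' → Obs k l) → (I → Obs k l) → ℝ≥0∞ := fun d v =>
    ENNReal.ofReal ((∑ i, imputationError π g p (fun x => muHat d x - mu x) (v i)) ^ 2)
  have hf : Measurable (Function.uncurry f) := by
    have h : ∀ i : I, Measurable fun z : (I' → Obs k l) × (I → Obs k l) =>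
        muHat z.1 (z.2 i).feat := fun i =>
      hmuHat.comp (measurable_fst.prodMk (Obs.measurable_feat.comp
        ((measurable_pi_apply i).comp measurable_snd)))
    simp only [f, Function.uncurry_def, imputationError]
    fun_prop
  have hsum : ∀ d ω, f d (fun i => W i ω) = ENNReal.ofReal
      ((∑ i ∈ I, imputationError π g p (fun x => muHat d x - mu x) (W i ω)) ^ 2) := fun d ω => by
    simp only [f]
    rw [← Finset.sum_coe_sort I]
  have h1 := lintegral_indepFun_prod hU hV (hind.indepFun_finset I' I hdisj.symm hWm) hf
  simp only [hsum] at h1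
  have hrem : ∀ ω, ENNReal.ofReal (remainder π g p mu W I I' muHat ω ^ 2)
      = ENNReal.ofReal ((I.card : ℝ)⁻¹) * ENNReal.ofReal ((∑ i ∈ I, imputationError π g p
        (fun x => muHat (fun i => W i ω) x - mu x) (W i ω)) ^ 2) := fun ω => by
    rw [remainder, mul_pow, inv_pow, Real.sq_sqrt (Nat.cast_nonneg _),
      ENNReal.ofReal_mul (by positivity)]
  have hmeasδ : ∀ d, Measurable fun x => muHat d x - mu x := fun d =>
    (hmuHat.comp measurable_prodMk_left).sub hmu
  calc ∫⁻ ω, ENNReal.ofReal (remainder π g p mu W I I' muHat ω ^ 2) ∂ρ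
      = ENNReal.ofReal ((I.card : ℝ)⁻¹) * ∫⁻ ω', ∫⁻ ω, ENNReal.ofReal ((∑ i ∈ I,
          imputationError π g p (fun x => muHat (fun i => W i ω') x - mu x) (W i ω)) ^ 2) ∂ρ ∂ρ := by
        simp_rw [hrem]
        rw [lintegral_const_mul' _ _ ENNReal.ofReal_ne_top, h1]
    _ ≤ ENNReal.ofReal ((I.card : ℝ)⁻¹) * ∫⁻ ω', I.card * (ENNReal.ofReal ((|p⁻¹| * η⁻¹) ^ 2)
          * ∫⁻ x, ENNReal.ofReal ((muHat (fun i => W i ω') x - mu x) ^ 2) ∂(P.map Obs.feat)) ∂ρ := by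
        gcongr with ω'
        exact lintegral_sq_imputationError_le hπ hP hg hp (hmeasδ _) hWm hW hind I
    _ = (ENNReal.ofReal ((I.card : ℝ)⁻¹) * I.card) * (ENNReal.ofReal ((|p⁻¹| * η⁻¹) ^ 2)
          * mse ρ P W I' muHat mu) := by
        rw [lintegral_const_mul' _ _ (ENNReal.natCast_ne_top _),
          lintegral_const_mul' _ _ ENNReal.ofReal_ne_top, mul_assoc]
        rfl
    -- An inequality rather than an equality, since |I|⁻¹ |I| is 0 when I is empty.
    _ ≤ 1 * _ := by
        gcongr
        rw [← ENNReal.ofReal_natCast, ← ENNReal.ofReal_mul (by positivity), ← ENNReal.ofReal_one]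
        exact ENNReal.ofReal_le_ofReal inv_mul_le_one
    _ = _ := one_mul _

lemma tendsto_eLpNorm_remainder [IsProbabilityMeasure P] (hπ : Overlap π η)
    (hP : Scored π P) (hg : IsGroup g e) {p : ℝ} (hp : p ≠ 0) (hmu : Measurable mu)
    (hWm : ∀ i, Measurable (W i)) (hW : ∀ i, ρ.map (W i) = P) (hind : iIndepFun W ρ)
    {I I' : ℕ → Finset ℕ} (hdisj : ∀ N, Disjoint (I N) (I' N))
    {muHat : (N : ℕ) → (I' N → Obs k l) → Feat k l → ℝ}
    (hmuHat : ∀ N, Measurable (Function.uncurry (muHat N)))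
    (hmse : Tendsto (fun N => mse ρ P W (I' N) (muHat N) mu) atTop (𝓝 0)) :
    Tendsto (fun N => eLpNorm (remainder π g p mu W (I N) (I' N) (muHat N)) 2 ρ) atTop (𝓝 0) := by
  have h1 : Tendsto (fun N => ENNReal.ofReal ((|p⁻¹| * η⁻¹) ^ 2)
      * mse ρ P W (I' N) (muHat N) mu) atTop (𝓝 0) := by
    simpa using ENNReal.Tendsto.const_mul hmse (.inr ENNReal.ofReal_ne_top)
  have h2 : Tendsto (fun N => ∫⁻ ω, ENNReal.ofReal
      (remainder π g p mu W (I N) (I' N) (muHat N) ω ^ 2) ∂ρ) atTop (𝓝 0) :=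
    tendsto_of_tendsto_of_tendsto_of_le_of_le tendsto_const_nhds h1 (fun _ => zero_le)
      fun N => lintegral_sq_remainder_le hπ hP hg hp hmu hWm hW hind (hdisj N) (hmuHat N)
  have h3 := (ENNReal.continuous_rpow_const (y := (1 / 2 : ℝ))).tendsto 0 |>.comp h2
  rw [ENNReal.zero_rpow_of_pos (by norm_num)] at h3
  refine h3.congr fun N => ?_
  rw [eLpNorm_eq_lintegral_rpow_enorm_toReal (by simp) (by simp)]
  simp only [Function.comp_apply, ENNReal.toReal_ofNat]
  congr 1
  refine lintegral_congr fun ω => ?_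
  rw [Real.enorm_eq_ofReal_abs, ENNReal.ofReal_rpow_of_nonneg (abs_nonneg _) (by norm_num)]
  simp

end Sample

end DiD

/-! ### Asymptotic normality of the estimator -/

namespace DiD

variable {k l : ℕ} {π : (Fin 2 → Fin k → ℝ) → ℝ} {η : ℝ} {P : Measure (Obs k l)}
  {muG muC : Feat k l → ℝ}

lemma measurable_eif (hπ : Measurable π) (hG : Measurable muG) (hC : Measurable muC) :
    Measurable (eif P π muG muC) :=
  ((measurable_aipw hπ Obs.measurable_G hG _).sub_const _).sub
    ((measurable_aipw hπ Obs.measurable_C hC _).sub_const _)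

lemma Assumptions.map_obs_cohort_ne_zero {F : Measure (Full k l)} [IsProbabilityMeasure F]
    (hF : Assumptions F π) : F.map Full.obs {w | w.G} ≠ 0 := by
  rw [Measure.map_apply Full.measurable_obs (measurableSet_eq_true Obs.measurable_G)]
  exact hF.pos_cohort.ne'

lemma Assumptions.map_obs_never_ne_zero {F : Measure (Full k l)} [IsProbabilityMeasure F]
    (hF : Assumptions F π) : F.map Full.obs {w | w.C} ≠ 0 := by
  rw [Measure.map_apply Full.measurable_obs (measurableSet_eq_true Obs.measurable_C)]
  exact hF.pos_never.ne'

/-- Linear expansion of the normalized estimator of one of the two group means. -/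
lemma sqrt_mul_estimator_sub {Ω : Type*} {g : Obs k l → Bool} {mu : Feat k l → ℝ}
    (W : ℕ → Ω → Obs k l) (I I' : Finset ℕ) (muHat : (I' → Obs k l) → Feat k l → ℝ) (ω : Ω) :
    √(I.card : ℝ) * (estimator P π g (muHat fun i => W i ω) I (fun i => W i ω)
        - ∫ w, mu w.feat ∂P[|{w | g w}])
      = (√(I.card : ℝ))⁻¹ * ∑ i ∈ I, influence P π g mu (W i ω)
        + remainder π g (P.real {w | g w}) mu W I I' muHat ω := by
  -- For an empty sample both sides are 0, because √0 = 0 and its inverse is 0 by convention.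
  rcases I.eq_empty_or_nonempty with rfl | hne
  · simp [remainder]
  have hn : 0 < √(I.card : ℝ) := Real.sqrt_pos.2 (by exact_mod_cast hne.card_pos)
  have h1 : ∀ c : ℝ, √(I.card : ℝ) * (1 / (I.card : ℝ) * c) = (√(I.card : ℝ))⁻¹ * c := fun c => by
    have := Real.sq_sqrt (Nat.cast_nonneg (α := ℝ) I.card)
    conv_lhs => rw [← this, Real.sqrt_sq hn.le]
    field_simp
  have h2 : ∀ c : ℝ, √(I.card : ℝ) * c = (√(I.card : ℝ))⁻¹ * (I.card * c) := fun c => by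
    have := Real.sq_sqrt (Nat.cast_nonneg (α := ℝ) I.card)
    conv_rhs => rw [← this, Real.sqrt_sq hn.le]
    field_simp
  rw [mul_sub, estimator, h1, h2, remainder, ← mul_sub, ← mul_add]
  simp only [← aipw_sub_aipw, influence, Finset.sum_sub_distrib, Finset.sum_const, nsmul_eq_mul]
  ring

/-- Asymptotic normality of the difference of the group estimators, with imputation functions
fitted on an independent sample. -/
theorem tendstoInDistribution_estimator_sub [IsProbabilityMeasure P] (hπ : Overlap π η)
    (hP : P ∈ model π) (hG : IsRegression Obs.G P muG) (hC : IsRegression Obs.C P muC)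
    (hpG : P {w | w.G} ≠ 0) (hpC : P {w | w.C} ≠ 0)
    {Ω : Type*} [MeasurableSpace Ω] {ρ : Measure Ω} [IsProbabilityMeasure ρ]
    {W : ℕ → Ω → Obs k l} (hWm : ∀ i, Measurable (W i)) (hW : ∀ i, ρ.map (W i) = P)
    (hind : iIndepFun W ρ) {I I' : ℕ → Finset ℕ} (hdisj : ∀ N, Disjoint (I N) (I' N))
    (hI : Tendsto (fun N => (I N).card) atTop atTop)
    {muHatG muHatC : (N : ℕ) → (I' N → Obs k l) → Feat k l → ℝ}
    (hmuHatG : ∀ N, Measurable (Function.uncurry (muHatG N)))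
    (hmuHatC : ∀ N, Measurable (Function.uncurry (muHatC N)))
    (hmseG : Tendsto (fun N => mse ρ P W (I' N) (muHatG N) muG) atTop (𝓝 0))
    (hmseC : Tendsto (fun N => mse ρ P W (I' N) (muHatC N) muC) atTop (𝓝 0)) :
    TendstoInDistribution (fun N ω => √((I N).card : ℝ)
        * (estimator P π Obs.G (muHatG N (fun i => W i ω)) (I N) (fun i => W i ω)
          - estimator P π Obs.C (muHatC N (fun i => W i ω)) (I N) (fun i => W i ω)
          - identified (P.real {w | w.G}) (P.real {w | w.C}) P)) atTop
      (id : ℝ → ℝ) (fun _ => ρ) (gaussianReal 0 Var[eif P π muG muC; P].toNNReal) := by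
  have hS : Scored π P := (scored_iff hπ _).2 hP.2.2.2.2
  have hm := measurable_eif (P := P) hπ.measurable hG.1 hC.1
  have hL := memLp_eif hπ hP hG hC
  let X : ℕ → Ω → ℝ := fun i ω => eif P π muG muC (W i ω)
  have hX : MemLp (X 0) 2 ρ := by
    have h : MemLp (eif P π muG muC) 2 (ρ.map (W 0)) := by rw [hW 0]; exact hL
    exact h.comp_of_map (hWm 0).aemeasurable
  have hmean : ∫ ω, X 0 ω ∂ρ = 0 := by
    rw [← integral_eif hπ hP hG hC hpG hpC]
    conv_rhs => rw [← hW 0]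
    rw [integral_map (hWm 0).aemeasurable (by rw [hW 0]; exact hm.aestronglyMeasurable), hW 0]
  have hvar : Var[X 0; ρ] = Var[eif P π muG muC; P] := by
    rw [variance_of_integral_eq_zero hX.1.aemeasurable hmean,
      variance_of_integral_eq_zero hm.aemeasurable (integral_eif hπ hP hG hC hpG hpC)]
    conv_rhs => rw [← hW 0]
    rw [integral_map (hWm 0).aemeasurable
      (by rw [hW 0]; exact (hm.pow_const 2).aestronglyMeasurable), hW 0]
  have hident : ∀ i, IdentDistrib (X i) (X 0) ρ ρ := fun i =>
    (IdentDistrib.mk (hWm i).aemeasurable (hWm 0).aemeasurable ((hW i).trans (hW 0).symm)).comp hm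
  have hclt := tendstoInDistribution_finset hX hmean (hind.comp (fun _ => eif P π muG muC)
    fun _ => hm) hident hI
  rw [hvar] at hclt
  have hp : ∀ {s : Set (Obs k l)}, P s ≠ 0 → P.real s ≠ 0 := fun h =>
    (measureReal_ne_zero_iff).2 h
  let RG : ℕ → Ω → ℝ := fun N => remainder π Obs.G (P.real {w | w.G}) muG W (I N) (I' N) (muHatG N)
  let RC : ℕ → Ω → ℝ := fun N => remainder π Obs.C (P.real {w | w.C}) muC W (I N) (I' N) (muHatC N)
  have mRG : ∀ N, Measurable (RG N) := fun N =>
    measurable_remainder hπ.measurable Obs.measurable_G hG.1 _ hWm _ _ (hmuHatG N)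
  have mRC : ∀ N, Measurable (RC N) := fun N =>
    measurable_remainder hπ.measurable Obs.measurable_C hC.1 _ hWm _ _ (hmuHatC N)
  have hRG : Tendsto (fun N => eLpNorm (RG N) 2 ρ) atTop (𝓝 0) :=
    tendsto_eLpNorm_remainder hπ hS isGroup_G (hp hpG) hG.1 hWm hW hind hdisj hmuHatG hmseG
  have hRC : Tendsto (fun N => eLpNorm (RC N) 2 ρ) atTop (𝓝 0) :=
    tendsto_eLpNorm_remainder hπ hS isGroup_C (hp hpC) hC.1 hWm hW hind hdisj hmuHatC hmseC
  have hR : Tendsto (fun N => eLpNorm (RG N - RC N) 2 ρ) atTop (𝓝 0) :=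
    tendsto_of_tendsto_of_tendsto_of_le_of_le tendsto_const_nhds
      (by simpa using hRG.add hRC) (fun _ => zero_le) fun N =>
        eLpNorm_sub_le (mRG N).aestronglyMeasurable (mRC N).aestronglyMeasurable one_le_two
  have hdecomp : (fun N ω => √((I N).card : ℝ)
        * (estimator P π Obs.G (muHatG N (fun i => W i ω)) (I N) (fun i => W i ω)
          - estimator P π Obs.C (muHatC N (fun i => W i ω)) (I N) (fun i => W i ω)
          - identified (P.real {w | w.G}) (P.real {w | w.C}) P))
      = fun N ω => (√((I N).card : ℝ))⁻¹ * ∑ i ∈ I N, X i ω + (RG N - RC N) ω := by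
    funext N ω
    have e1 := sqrt_mul_estimator_sub (P := P) (π := π) (g := Obs.G) (mu := muG) W (I N) (I' N)
      (muHatG N) ω
    have e2 := sqrt_mul_estimator_sub (P := P) (π := π) (g := Obs.C) (mu := muC) W (I N) (I' N)
      (muHatC N) ω
    simp only [X, eif, Finset.sum_sub_distrib, Pi.sub_apply, RG, RC]
    rw [identified_eq_sub hπ hP hG hC hpG hpC]
    linear_combination e1 - e2
  rw [hdecomp]
  -- Slutsky's lemma: the difference from the normalized sum of influence values tends to zero in
  -- L², hence in probability.
  refine tendstoInDistribution_of_tendstoInMeasure_sub _ _ hclt ?_ fun N =>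
    (hclt.forall_aemeasurable N).add ((mRG N).sub (mRC N)).aemeasurable
  refine tendstoInMeasure_of_tendsto_eLpNorm two_ne_zero (fun N => ?_) (by fun_prop) ?_
  · exact (((hclt.forall_aemeasurable N).add ((mRG N).sub (mRC N)).aemeasurable).sub
      (hclt.forall_aemeasurable N)).aestronglyMeasurable
  · refine hR.congr fun N => ?_
    congr 1
    ext ω
    simp [X]

end DiD

theorem mainTheorem7 {k l : ℕ}
    -- the law `F` of the complete data, the law `P` of the observed data
    (F : Measure (DiD.Full k l)) [IsProbabilityMeasure F]
    (π : (Fin 2 → Fin k → ℝ) → ℝ) (hF : DiD.Assumptions F π)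
    (P : Measure (DiD.Obs k l)) (hP : P = F.map DiD.Full.obs)
    -- the regression functions `μ_G`, `μ_C`
    (muG muC : DiD.Feat k l → ℝ)
    (hmuG : DiD.IsRegression DiD.Obs.G P muG) (hmuC : DiD.IsRegression DiD.Obs.C P muC)
    -- an iid sample from `P`
    {Ω : Type*} [MeasurableSpace Ω] (ρ : Measure Ω) [IsProbabilityMeasure ρ]
    (W : ℕ → Ω → DiD.Obs k l) (hWm : ∀ i, Measurable (W i))
    (hW : ∀ i, ρ.map (W i) = P) (hWind : iIndepFun W ρ)
    -- disjoint estimation and tuning samples, whose sizes tend to infinity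
    (I I' : ℕ → Finset ℕ) (hdisj : ∀ N, Disjoint (I N) (I' N))
    (hI : Tendsto (fun N => (I N).card) atTop atTop)
    (hI' : Tendsto (fun N => (I' N).card) atTop atTop)
    -- imputation functions estimated on the tuning sample, consistent in mean square
    (muHatG muHatC : (N : ℕ) → (I' N → DiD.Obs k l) → DiD.Feat k l → ℝ)
    (hmuHatG : ∀ N, Measurable (Function.uncurry (muHatG N)))
    (hmuHatC : ∀ N, Measurable (Function.uncurry (muHatC N)))
    (hmseG : Tendsto (fun N => DiD.mse ρ P W (I' N) (muHatG N) muG) atTop (𝓝 0))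
    (hmseC : Tendsto (fun N => DiD.mse ρ P W (I' N) (muHatC N) muC) atTop (𝓝 0)) :
    let φ : DiD.Obs k l → ℝ :=
      fun w => DiD.influence P π DiD.Obs.G muG w - DiD.influence P π DiD.Obs.C muC w
    let ψ : Measure (DiD.Obs k l) → ℝ :=
      DiD.identified (P.real {w | w.G}) (P.real {w | w.C})
    let θhat : ℕ → Ω → ℝ := fun N ω =>
      DiD.estimator P π DiD.Obs.G (muHatG N (fun i => W i ω)) (I N) (fun i => W i ω)
        - DiD.estimator P π DiD.Obs.C (muHatC N (fun i => W i ω)) (I N) (fun i => W i ω)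
    -- `ψ` identifies the average treatment effect on the treated
    ψ P = DiD.att F ∧
    -- asymptotic normality
    TendstoInDistribution (fun N ω => Real.sqrt ((I N).card : ℝ) * (θhat N ω - DiD.att F)) atTop
      (id : ℝ → ℝ) (fun _ => ρ) (gaussianReal 0 (Var[φ; P]).toNNReal) ∧
    -- `φ` is the efficient influence function
    Semiparametric.IsEfficientInfluenceFunction (DiD.regularPaths π) ψ P φ := by
  subst hP
  obtain ⟨η, hπ⟩ := hF.exists_overlap
  have := Measure.isProbabilityMeasure_map (μ := F) DiD.Full.measurable_obs.aemeasurable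
  have hpG := hF.map_obs_cohort_ne_zero
  have hpC := hF.map_obs_never_ne_zero
  refine ⟨hF.identified_eq_att, ?_,
    DiD.isEfficientInfluenceFunction_eif hπ hF.mem_model hmuG hmuC hpG hpC⟩
  rw [← hF.identified_eq_att]
  exact DiD.tendstoInDistribution_estimator_sub hπ hF.mem_model hmuG hmuC hpG hpC hWm hW hWind
    hdisj hI hmuHatG hmuHatC hmseG hmseC
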